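/- Let $b\ge 2$ be an integer and $\omega_b:=e^{2\pi\sqrt{-1}/b}$. Write a positive integer $k$ in base $b$ as $k=\kappa_1b^{a_1-1}+\cdots+\kappa_vb^{a_v-1}$ with $0<\kappa_i\le b-1$ and $a_1>\cdots>a_v\ge 1$, and for an integer $\alpha\ge1$ put $\mu_\alpha(k):=a_1+\cdots+a_{\min(\alpha,v)}$. For $x\in[0,1)$ with $b$-adic expansion $x=\xi_1b^{-1}+\xi_2b^{-2}+\cdots$ (infinitely many $\xi_i$ different from $b-1$) let $\mathrm{wal}_k(x):=\omega_b^{\kappa_1\xi_{a_1}+\cdots+\kappa_v\xi_{a_v}}$, and let $\widehat f(k):=\int_0^1 f(x)\overline{\mathrm{wal}_k(x)}\,dx$. Let $H_\alpha$ be the space of functions $f\colon[0,1]\to\mathbb{R}$ such that $f^{(i)}$ is absolutely continuous for $i=0,\dots,\alpha-1$ and $f^{(\alpha)}\in L^2[0,1]$. Put $m_b:=2\sin(\pi/b)$, and $M_b:=2$ if $b$ is even, $M_b:=2\sin\bigl((b+1)\pi/(2b)\bigr)$ if $b$ is odd. Let $\alpha$ and $k$ be positive integers and let $1\le p,q\le\infty$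 with $1/p+1/q=1$. Then for all $f\in H_\alpha$, $$|\widehat f(k)|\le b^{-\mu_\alpha(k)}\,C_{b,\alpha,q}\,\|f\|_{p,\alpha},$$ where $$\|f\|_{p,\alpha}:=\left(\sum_{i=0}^{\alpha}\left|\int_0^1f^{(i)}(x)\,dx\right|^p+\int_0^1|f^{(\alpha)}(x)|^p\,dx\right)^{1/p}\in[0,\infty],$$ $$C_{b,\alpha,q}:=\left(\sum_{i=1}^{\alpha}\frac1{m_b^{iq}}\left(1+\frac{b\,m_b}{b-M_b}\right)^q+\frac1{m_b^{\alpha q}}\left(M_b+\frac{b\,m_b}{b-M_b}\right)^q\right)^{1/q}\quad\text{for } b>2,$$ $$C_{2,\alpha,q}:=\left(\sum_{i=1}^{\alpha}2^{-iq}+2^{-(\alpha-1)q}\right)^{1/q}.$$ For $p=\infty$ or $q=\infty$ these expressions are understood in the usual sense: the $\ell^p$ (resp. $\ell^q$) sum is replaced by the maximum of the terms, and $\bigl(\int_0^1|f^{(\alpha)}|^p\bigr)^{1/p}$ by the essential supremum of $|f^{(\alpha)}|$ on $[0,1]$. -/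

import Mathlib

open scoped ENNReal

noncomputable section

namespace WalshSobolev

/-- The coefficient of `b ^ j` in the `b`-adic expansion of the nonnegative integer `k`. -/
def natDigit (b k j : ℕ) : ℕ := (Nat.digits b k).getD j 0

/-- The list `[a₁, …, a_v]`, in decreasing order, of the positions of the nonzero digits in the
`b`-adic expansion `k = κ₁ b ^ (a₁ - 1) + ⋯ + κ_v b ^ (a_v - 1)`, `a₁ > ⋯ > a_v ≥ 1`.
It is empty for `k = 0`. -/
def positions (b k : ℕ) : List ℕ :=
  ((List.range (Nat.digits b k).length).reverse.filter (fun j => natDigit b k j ≠ 0)).map (· + 1)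

/-- `μ_α(k) = a₁ + ⋯ + a_{min(α, v)}`. -/
def mu (b α k : ℕ) : ℕ := ((positions b k).take α).sum

/-- The `b`-adic `k`-th Walsh function `wal_k(x) = ω_b ^ (κ₁ ξ_{a₁} + ⋯ + κ_v ξ_{a_v})` for
`x = ξ₁ b⁻¹ + ξ₂ b⁻² + ⋯` in `[0, 1)` and `ω_b = exp (2 π i / b)`. `Real.digits x b j` is
`ξ_{j+1} = ⌊x b ^ (j+1)⌋ mod b`; these are the digits of the expansion of `x` in which infinitely
many digits differ from `b - 1`. -/
def wal (b : ℕ) [NeZero b] (k : ℕ) (x : ℝ) : ℂ :=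
  Complex.exp (2 * Real.pi * Complex.I / b) ^
    (∑ j ∈ Finset.range (Nat.digits b k).length, natDigit b k j * (Real.digits x b j : ℕ))

/-- The `k`-th Walsh coefficient of `f`. -/
def walshCoeff (b : ℕ) [NeZero b] (f : ℝ → ℝ) (k : ℕ) : ℂ :=
  ∫ x in Set.Ico (0 : ℝ) 1, (f x : ℂ) * (starRingEnd ℂ) (wal b k x)

/-- The `i`-th derivative of `f` as a function on `[0, 1]` (one-sided at the end points). -/
def der (i : ℕ) (f : ℝ → ℝ) : ℝ → ℝ := iteratedDerivWithin i f (Set.Icc 0 1)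

/-- The Sobolev space of the functions `f` on `[0, 1]` for which `f, f', …, f^(α-1)` exist
everywhere and are absolutely continuous and `f^(α)`, which then exists almost everywhere, is in
`L²[0, 1]`. Only the values of `f` on `[0, 1]` matter. -/
def Sob (α : ℕ) : Set (ℝ → ℝ) :=
  {f | (∀ i, i + 1 < α → DifferentiableOn ℝ (der i f) (Set.Icc 0 1)) ∧
    (∀ i, i < α → AbsolutelyContinuousOnInterval (der i f) 0 1) ∧
    MeasureTheory.MemLp (der α f) 2 (MeasureTheory.volume.restrict (Set.Icc 0 1))}

/-- `‖f‖_{p,α} = (∑_{i=0}^α |∫₀¹ f^(i)|^p + ∫₀¹ |f^(α)|^p)^{1/p}` for `1 ≤ p < ∞`, with the usual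
modification (maximum and essential supremum) for `p = ∞`. The value is `∞` if `f^(α)` is not
in `L^p[0, 1]`. -/
def sobNorm (p : ℝ≥0∞) (α : ℕ) (f : ℝ → ℝ) : ℝ≥0∞ :=
  if p = ∞ then
    max ((Finset.range (α + 1)).sup fun i => ‖∫ x in (0 : ℝ)..1, der i f x‖ₑ)
      (essSup (fun x => ‖der α f x‖ₑ) (MeasureTheory.volume.restrict (Set.Icc 0 1)))
  else
    ((∑ i ∈ Finset.range (α + 1), ‖∫ x in (0 : ℝ)..1, der i f x‖ₑ ^ p.toReal) +
      ∫⁻ x in Set.Icc (0 : ℝ) 1, ‖der α f x‖ₑ ^ p.toReal) ^ (1 / p.toReal)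

/-- `m_b = 2 sin (π / b)`, the minimum of `|1 - ω_b ^ c|` over `1 ≤ c ≤ b - 1`. -/
def mConst (b : ℕ) : ℝ := 2 * Real.sin (Real.pi / b)

/-- `M_b`, the maximum of `|1 - ω_b ^ c|` over `1 ≤ c ≤ b - 1`. -/
def MConst (b : ℕ) : ℝ :=
  if Even b then 2 else 2 * Real.sin ((b + 1) * Real.pi / (2 * b))

/-- The constant `C_{b,α,q}` for `b > 2`; for `q = ∞` the sum is replaced by the maximum. -/
def boundConstNonDyadic (b α : ℕ) (q : ℝ≥0∞) : ℝ :=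
  if q = ∞ then
    max
      (⨆ i : Finset.Icc 1 α,
        1 / mConst b ^ (i : ℕ) * (1 + b * mConst b / (b - MConst b)))
      (1 / mConst b ^ α * (MConst b + b * mConst b / (b - MConst b)))
  else
    ((∑ i ∈ Finset.Icc 1 α,
        1 / mConst b ^ (i * q.toReal) *
          (1 + b * mConst b / (b - MConst b)) ^ q.toReal) +
      1 / mConst b ^ (α * q.toReal) *
        (MConst b + b * mConst b / (b - MConst b)) ^ q.toReal) ^ (1 / q.toReal)

/-- The constant `C_{2,α,q}`; for `q = ∞` the sum is replaced by the maximum. -/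
def boundConstDyadic (α : ℕ) (q : ℝ≥0∞) : ℝ :=
  if q = ∞ then
    max (⨆ i : Finset.Icc 1 α, (2 : ℝ) ^ (-((i : ℕ) : ℝ))) ((2 : ℝ) ^ (-((α : ℝ) - 1)))
  else
    ((∑ i ∈ Finset.Icc 1 α, (2 : ℝ) ^ (-((i : ℝ) * q.toReal))) +
      (2 : ℝ) ^ (-(((α : ℝ) - 1) * q.toReal))) ^ (1 / q.toReal)

/-- The constant `C_{b,α,q}` for every base `b ≥ 2`. -/
def boundConst (b α : ℕ) (q : ℝ≥0∞) : ℝ :=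
  if b = 2 then boundConstDyadic α q else boundConstNonDyadic b α q

end WalshSobolev

end

/-! The conjugate Walsh function is a product of step functions `ω_j ^ ⌊b ^ j x⌋` with
`ω_j ^ b = 1`, one for each nonzero digit of `k`. Integrating by parts from the finest factor on,
every step removes one factor, replaces `f` by `f'` and gains `b ^ (-a_j) / m_b`: the coarser
factors are constant on each period of the primitive of the finest one, and that primitive vanishes
at the ends of these periods.

What has been integrated is a periodic function `φ`. Translation by the shorter period of the
preceding primitive acts on it as a rotation by a root of unity about its mean value, so `φ` has
mean value at most its size `B` and deviates from it by at most `d B`, with `d` depending only on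
`b`. If the derivatives of `f` are used up first, `|φ| ≤ (1 + d) B` suffices. If the digits of `k`
are, then `∫ f^(i) φ` is left: the mean of `φ` contributes `B |∫ f^(i)|`, and one continues to
integrate by parts against primitives of functions of mean zero, each of which gains
`1 / 2 ≤ 1 / m_b`. Since `1 + d` is at most the last coefficient of `C_{b,α,q}`, Hölder's
inequality finishes the proof. -/

open MeasureTheory intervalIntegral

namespace WalshSobolev

theorem periodic_of_add_eq_smul {R M X : Type*} [Semiring R] [Monoid M] [MulAction M X] {g : R → X}
    {ω : M} {h : R} (hg : ∀ x, g (x + h) = ω • g x) {b : ℕ} (hω : ω ^ b = 1) :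
    Function.Periodic g (b * h) := by
  have iterate (n : ℕ) : ∀ x, g (x + n * h) = ω ^ n • g x := by
    induction n with
    | zero => simp
    | succ n ih =>
      intro x
      rw [Nat.cast_succ, add_one_mul, ← add_assoc, hg, ih, smul_smul, pow_succ']
  intro x
  rw [iterate, hω, one_smul]

section PeriodicIntegrals

variable {E : Type*} [NormedAddCommGroup E] [NormedSpace ℝ E] {g : ℝ → E}

theorem norm_integral_le_half_integral_norm {a c x y : ℝ} (hac : a ≤ c)
    (hg : IntervalIntegrable g volume a c) (hg₀ : ∫ t in a..c, g t = 0)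
    (hx : x ∈ Set.Icc a c) (hy : y ∈ Set.Icc a c) :
    ‖∫ t in x..y, g t‖ ≤ (∫ t in a..c, ‖g t‖) / 2 := by
  wlog hxy : x ≤ y generalizing x y
  · rw [integral_symm, norm_neg]
    exact this hy hx (le_of_not_ge hxy)
  have sub {u v : ℝ} (hu : u ∈ Set.Icc a c) (hv : v ∈ Set.Icc a c) :
      IntervalIntegrable g volume u v :=
    hg.mono_set (Set.uIcc_subset_uIcc (Set.Icc_subset_uIcc hu) (Set.Icc_subset_uIcc hv))
  have ha : a ∈ Set.Icc a c := Set.left_mem_Icc.2 hac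
  have hc : c ∈ Set.Icc a c := Set.right_mem_Icc.2 hac
  have split : (∫ t in a..x, g t) + (∫ t in x..y, g t) + ∫ t in y..c, g t = 0 := by
    rw [integral_add_adjacent_intervals (sub ha hx) (sub hx hy),
      integral_add_adjacent_intervals (sub ha hy) (sub hy hc), hg₀]
  have split_norm : (∫ t in a..c, ‖g t‖) =
      (∫ t in a..x, ‖g t‖) + (∫ t in x..y, ‖g t‖) + ∫ t in y..c, ‖g t‖ := by
    rw [integral_add_adjacent_intervals (sub ha hx).norm (sub hx hy).norm,
      integral_add_adjacent_intervals (sub ha hy).norm (sub hy hc).norm]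
  have outside : ‖∫ t in x..y, g t‖ ≤ ‖∫ t in a..x, g t‖ + ‖∫ t in y..c, g t‖ := by
    rw [← norm_neg, show -(∫ t in x..y, g t) = (∫ t in a..x, g t) + ∫ t in y..c, g t by
      rw [← sub_eq_zero, ← neg_eq_zero, ← split]; abel]
    exact norm_add_le _ _
  linarith [norm_integral_le_integral_norm (f := g) (μ := volume) hx.1,
    norm_integral_le_integral_norm (f := g) (μ := volume) hxy,
    norm_integral_le_integral_norm (f := g) (μ := volume) hy.2]

theorem integral_zero_one_of_periodic {h : ℝ} (hp : Function.Periodic g h)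
    (hg : ∀ a c, IntervalIntegrable g volume a c) {N : ℕ} (hN : N * h = 1) :
    ∫ t in (0 : ℝ)..1, g t = N • ∫ t in (0 : ℝ)..h, g t := by
  simpa [hN] using hp.intervalIntegral_add_zsmul_eq N 0 hg

theorem integral_eq_zero_of_add_eq_smul [NormedSpace ℂ E] {ω : ℂ} {h : ℝ}
    (hg : ∀ x, g (x + h) = ω • g x) {b : ℕ} (hω : ω ^ b = 1) (hω₁ : ω ≠ 1) :
    ∫ t in (0 : ℝ)..(b * h), g t = 0 := by
  have hshift := (periodic_of_add_eq_smul hg hω).intervalIntegral_add_eq h 0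
  have hsmul := integral_comp_add_right (a := 0) (b := b * h) g h
  simp only [hg, intervalIntegral.integral_smul, zero_add] at hshift hsmul
  rw [add_comm (b * h : ℝ) h, hshift] at hsmul
  have : (ω - 1) • ∫ t in (0 : ℝ)..(b * h), g t = 0 := by rw [sub_smul, hsmul, one_smul, sub_self]
  exact (smul_eq_zero.1 this).resolve_left (sub_ne_zero.2 hω₁)

end PeriodicIntegrals

section StepPrimitive

/-- The primitive `x ↦ ∫₀ˣ ω ^ ⌊t / h⌋ φ(t) dt` of the product of `φ` with the step function that
is multiplied by `ω` at the multiples of `h`. For a `b`-th root of unity `ω ≠ 1` this is how a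
factor `ω_b ^ (κ ξ_j)` of a Walsh function is integrated, with `h = b ^ (-j)`. -/
noncomputable def stepPrimitive (ω : ℂ) (h : ℝ) (φ : ℝ → ℂ) (x : ℝ) : ℂ :=
  ∫ t in (0 : ℝ)..x, ω ^ ⌊t / h⌋ * φ t

/-- The centre of the rotation that `stepPrimitive ω h φ` undergoes when its argument is translated
by the period `h` of `φ`; if `ω ^ b = 1` it is the mean value of `stepPrimitive ω h φ`. -/
noncomputable def stepCenter (ω : ℂ) (h : ℝ) (φ : ℝ → ℂ) : ℂ :=
  (∫ t in (0 : ℝ)..h, φ t) / (1 - ω)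

variable {φ : ℝ → ℂ} {ω : ℂ} {h : ℝ}

theorem measurable_zpow_floor_div (ω : ℂ) (h : ℝ) : Measurable fun t : ℝ => ω ^ ⌊t / h⌋ :=
  (measurable_of_countable fun n : ℤ => ω ^ n).comp
    (Int.measurable_floor.comp (measurable_id.div_const h))

theorem intervalIntegrable_zpow_floor_div_mul (hω : ‖ω‖ = 1) (h : ℝ) {a c : ℝ}
    (hφ : IntervalIntegrable φ volume a c) :
    IntervalIntegrable (fun t => ω ^ ⌊t / h⌋ * φ t) volume a c := by
  rw [intervalIntegrable_iff] at hφ ⊢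
  exact hφ.bdd_mul (c := 1) (measurable_zpow_floor_div ω h).aestronglyMeasurable
    (.of_forall fun x => by simp [hω])

theorem continuous_stepPrimitive (hω : ‖ω‖ = 1) (h : ℝ) (hφ : Continuous φ) :
    Continuous (stepPrimitive ω h φ) :=
  continuous_primitive
    (fun _ _ => intervalIntegrable_zpow_floor_div_mul hω h (hφ.intervalIntegrable _ _)) 0

theorem stepPrimitive_of_mem_Icc {x : ℝ} (hx : x ∈ Set.Icc 0 h) :
    stepPrimitive ω h φ x = ∫ t in (0 : ℝ)..x, φ t := by
  rw [stepPrimitive, integral_of_le hx.1, integral_of_le hx.1, ← integral_Ico_eq_integral_Ioc,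
    ← integral_Ico_eq_integral_Ioc]
  refine setIntegral_congr_fun measurableSet_Ico fun t ht => ?_
  have floor_eq : ⌊t / h⌋ = 0 := by
    have hh : 0 < h := by linarith [ht.1, ht.2, hx.2]
    rw [Int.floor_eq_zero_iff]
    exact ⟨div_nonneg ht.1 hh.le, (div_lt_one hh).2 (ht.2.trans_le hx.2)⟩
  simp [floor_eq]

theorem stepPrimitive_add (hω : ‖ω‖ = 1) (hh : 0 < h) (hφ : Continuous φ)
    (hp : Function.Periodic φ h) (x : ℝ) :
    stepPrimitive ω h φ (x + h) = (∫ t in (0 : ℝ)..h, φ t) + ω * stepPrimitive ω h φ x := by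
  have hω₀ : ω ≠ 0 := by rintro rfl; simp at hω
  have integrable (a c : ℝ) := intervalIntegrable_zpow_floor_div_mul hω h
    (hφ.intervalIntegrable (μ := volume) a c)
  have shift : ∫ t in h..(x + h), ω ^ ⌊t / h⌋ * φ t = ω * stepPrimitive ω h φ x := by
    have := integral_comp_add_right (a := 0) (b := x) (fun t => ω ^ ⌊t / h⌋ * φ t) h
    rw [zero_add] at this
    rw [← this, stepPrimitive, ← intervalIntegral.integral_const_mul]
    refine integral_congr fun t _ => ?_
    rw [hp t, add_div, div_self hh.ne', Int.floor_add_one, zpow_add_one₀ hω₀]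
    ring
  rw [← shift, ← stepPrimitive_of_mem_Icc (ω := ω) ⟨hh.le, le_rfl⟩, stepPrimitive, stepPrimitive,
    integral_add_adjacent_intervals (integrable 0 h) (integrable h (x + h))]

theorem stepPrimitive_add_sub_stepCenter (hω : ‖ω‖ = 1) (hω₁ : ω ≠ 1) (hh : 0 < h)
    (hφ : Continuous φ) (hp : Function.Periodic φ h) (x : ℝ) :
    stepPrimitive ω h φ (x + h) - stepCenter ω h φ =
      ω • (stepPrimitive ω h φ x - stepCenter ω h φ) := by
  have : 1 - ω ≠ 0 := sub_ne_zero.2 hω₁.symm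
  rw [stepPrimitive_add hω hh hφ hp, stepCenter, smul_eq_mul]
  field_simp
  ring

theorem periodic_norm_stepPrimitive_sub_stepCenter (hω : ‖ω‖ = 1) (hω₁ : ω ≠ 1) (hh : 0 < h)
    (hφ : Continuous φ) (hp : Function.Periodic φ h) :
    Function.Periodic (fun x => ‖stepPrimitive ω h φ x - stepCenter ω h φ‖) h := fun x => by
  simp only [stepPrimitive_add_sub_stepCenter hω hω₁ hh hφ hp, norm_smul, hω, one_mul]

theorem periodic_stepPrimitive {b : ℕ} (hω : ‖ω‖ = 1) (hω₁ : ω ≠ 1) (hωb : ω ^ b = 1) (hh : 0 < h)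
    (hφ : Continuous φ) (hp : Function.Periodic φ h) :
    Function.Periodic (stepPrimitive ω h φ) (b * h) := fun x => by
  simpa using periodic_of_add_eq_smul (g := fun x => stepPrimitive ω h φ x - stepCenter ω h φ)
    (stepPrimitive_add_sub_stepCenter hω hω₁ hh hφ hp) hωb x

theorem integral_stepPrimitive {b : ℕ} (hω : ‖ω‖ = 1) (hω₁ : ω ≠ 1) (hωb : ω ^ b = 1) (hh : 0 < h)
    (hφ : Continuous φ) (hp : Function.Periodic φ h) :
    ∫ x in (0 : ℝ)..(b * h), stepPrimitive ω h φ x = b * h * stepCenter ω h φ := by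
  have := integral_eq_zero_of_add_eq_smul (g := fun x => stepPrimitive ω h φ x - stepCenter ω h φ)
    (stepPrimitive_add_sub_stepCenter hω hω₁ hh hφ hp) hωb hω₁
  rw [intervalIntegral.integral_sub ((continuous_stepPrimitive hω h hφ).intervalIntegrable _ _)
    (by simp), sub_eq_zero] at this
  simpa using this

theorem norm_stepPrimitive_sub_stepCenter_le (hω : ‖ω‖ = 1) (hω₁ : ω ≠ 1) (hh : 0 < h)
    (hφ : Continuous φ) (hp : Function.Periodic φ h) (x : ℝ) :
    ‖stepPrimitive ω h φ x - stepCenter ω h φ‖ ≤ (∫ t in (0 : ℝ)..h, ‖φ t‖) / ‖1 - ω‖ := by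
  obtain ⟨y, hy, hxy⟩ :=
    (periodic_norm_stepPrimitive_sub_stepCenter hω hω₁ hh hφ hp).exists_mem_Ico₀ hh x
  have integrable (a c : ℝ) := hφ.intervalIntegrable (μ := volume) a c
  have chord : stepPrimitive ω h φ y - stepCenter ω h φ =
      -(ω * (∫ t in (0 : ℝ)..y, φ t) + ∫ t in y..h, φ t) / (1 - ω) := by
    have : 1 - ω ≠ 0 := sub_ne_zero.2 hω₁.symm
    rw [stepPrimitive_of_mem_Icc (Set.Ico_subset_Icc_self hy), stepCenter,
      ← integral_add_adjacent_intervals (integrable 0 y) (integrable y h)]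
    field_simp
    ring
  rw [hxy, chord, norm_div, norm_neg,
    ← integral_add_adjacent_intervals (integrable 0 y).norm (integrable y h).norm]
  gcongr
  refine (norm_add_le _ _).trans ?_
  rw [norm_mul, hω, one_mul]
  exact add_le_add (norm_integral_le_integral_norm hy.1) (norm_integral_le_integral_norm hy.2.le)

theorem norm_one_sub_mul_one_sub_le (hω : ‖ω‖ = 1) {t : ℝ} (ht : t ∈ Set.Icc 0 1) :
    ‖1 - t * (1 - ω)‖ ≤ 1 := by
  have := (convex_closedBall (0 : ℂ) 1) (x := 1) (y := ω) (by simp) (by simp [hω])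
    (sub_nonneg.2 ht.2) ht.1 (sub_add_cancel 1 t)
  rw [mem_closedBall_zero_iff] at this
  rwa [show 1 - t * (1 - ω) = (1 - t) • (1 : ℂ) + t • ω by
    simp only [Complex.real_smul]; push_cast; ring]

theorem norm_stepPrimitive_sub_stepCenter_le_add (hω : ‖ω‖ = 1) (hω₁ : ω ≠ 1) (hh : 0 < h)
    (hφ : Continuous φ) {I : ℂ} (hI : ∫ t in (0 : ℝ)..h, φ t = h * I) {y : ℝ}
    (hy : y ∈ Set.Icc 0 h) :
    ‖stepPrimitive ω h φ y - stepCenter ω h φ‖ ≤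
      ‖stepCenter ω h φ‖ + ‖∫ t in (0 : ℝ)..y, (φ t - I)‖ := by
  have hω₁' : 1 - ω ≠ 0 := sub_ne_zero.2 hω₁.symm
  have hh' : (h : ℂ) ≠ 0 := by exact_mod_cast hh.ne'
  have decomposition : stepPrimitive ω h φ y - stepCenter ω h φ =
      -stepCenter ω h φ * (1 - (y / h : ℝ) * (1 - ω)) + ∫ t in (0 : ℝ)..y, (φ t - I) := by
    rw [stepPrimitive_of_mem_Icc hy, stepCenter, hI,
      intervalIntegral.integral_sub (hφ.intervalIntegrable _ _) (by simp)]
    simp only [intervalIntegral.integral_const, sub_zero, Complex.real_smul]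
    push_cast
    field_simp
    ring
  rw [decomposition]
  refine (norm_add_le _ _).trans ?_
  gcongr
  rw [norm_mul, norm_neg]
  exact mul_le_of_le_one_right (norm_nonneg _) (norm_one_sub_mul_one_sub_le hω
    ⟨div_nonneg hy.1 hh.le, (div_le_one hh).2 hy.2⟩)

theorem integral_sub_mean (hφ : Continuous φ) {I : ℂ} (hI : ∫ t in (0 : ℝ)..h, φ t = h * I) :
    ∫ t in (0 : ℝ)..h, (φ t - I) = 0 := by
  rw [intervalIntegral.integral_sub (hφ.intervalIntegrable _ _) (by simp), hI]
  simp

theorem norm_integral_le_mul_min {E : Type*} [NormedAddCommGroup E] [NormedSpace ℝ E] {ψ : ℝ → E}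
    (hψ : IntervalIntegrable ψ volume 0 h) (hψ₀ : ∫ t in (0 : ℝ)..h, ψ t = 0) {D : ℝ}
    (hD : ∀ x, ‖ψ x‖ ≤ D) {y : ℝ} (hy : y ∈ Set.Icc 0 h) :
    ‖∫ t in (0 : ℝ)..y, ψ t‖ ≤ D * min y (h - y) := by
  have hyI : y ∈ Set.uIcc 0 h := Set.Icc_subset_uIcc hy
  have complement : ∫ t in (0 : ℝ)..y, ψ t = -∫ t in y..h, ψ t := by
    rw [← add_eq_zero_iff_eq_neg, integral_add_adjacent_intervals
      (hψ.mono_set (Set.uIcc_subset_uIcc_left hyI))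
      (hψ.mono_set (Set.uIcc_subset_uIcc_right hyI)), hψ₀]
  have left := norm_integral_le_of_norm_le_const (a := 0) (b := y) fun x _ => hD x
  have right := norm_integral_le_of_norm_le_const (a := y) (b := h) fun x _ => hD x
  rw [sub_zero, abs_of_nonneg hy.1] at left
  rw [abs_of_nonneg (sub_nonneg.2 hy.2), ← norm_neg, ← complement] at right
  rcases le_total y (h - y) with h' | h' <;> simp [h', left, right]

theorem integral_min_sub (hh : 0 ≤ h) : ∫ y in (0 : ℝ)..h, min y (h - y) = h ^ 2 / 4 := by
  have integrable (a c : ℝ) : IntervalIntegrable (fun y => min y (h - y)) volume a c :=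
    Continuous.intervalIntegrable (by fun_prop) a c
  have left : ∫ y in (0 : ℝ)..(h / 2), min y (h - y) = ∫ y in (0 : ℝ)..(h / 2), y :=
    integral_congr fun y hy => by
      rw [Set.uIcc_of_le (by linarith)] at hy
      exact min_eq_left (by linarith [hy.2])
  have right : ∫ y in (h / 2)..h, min y (h - y) = ∫ y in (h / 2)..h, (h - y) :=
    integral_congr fun y hy => by
      rw [Set.uIcc_of_le (by linarith)] at hy
      exact min_eq_right (by linarith [hy.1])
  rw [← integral_add_adjacent_intervals (integrable 0 (h / 2)) (integrable (h / 2) h), left, right,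
    intervalIntegral.integral_sub (by simp) (by simp)]
  simp only [integral_id, intervalIntegral.integral_const, smul_eq_mul]
  ring

theorem norm_stepPrimitive_sub_stepCenter_le_of_mean (hω : ‖ω‖ = 1) (hω₁ : ω ≠ 1) (hh : 0 < h)
    (hφ : Continuous φ) (hp : Function.Periodic φ h) {I : ℂ}
    (hI : ∫ t in (0 : ℝ)..h, φ t = h * I) (x : ℝ) :
    ‖stepPrimitive ω h φ x - stepCenter ω h φ‖ ≤
      ‖stepCenter ω h φ‖ + (∫ t in (0 : ℝ)..h, ‖φ t - I‖) / 2 := by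
  obtain ⟨y, hy, hxy⟩ :=
    (periodic_norm_stepPrimitive_sub_stepCenter hω hω₁ hh hφ hp).exists_mem_Ico₀ hh x
  have hy' := Set.Ico_subset_Icc_self hy
  rw [hxy]
  refine (norm_stepPrimitive_sub_stepCenter_le_add hω hω₁ hh hφ hI hy').trans ?_
  gcongr
  exact norm_integral_le_half_integral_norm hh.le
    ((hφ.sub continuous_const).intervalIntegrable _ _) (integral_sub_mean hφ hI)
    (Set.left_mem_Icc.2 hh.le) hy'

theorem integral_norm_stepPrimitive_sub_stepCenter_le (hω : ‖ω‖ = 1) (hω₁ : ω ≠ 1) (hh : 0 < h)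
    (hφ : Continuous φ) {I : ℂ} (hI : ∫ t in (0 : ℝ)..h, φ t = h * I) {D : ℝ}
    (hD : ∀ x, ‖φ x - I‖ ≤ D) :
    ∫ x in (0 : ℝ)..h, ‖stepPrimitive ω h φ x - stepCenter ω h φ‖ ≤
      h * ‖stepCenter ω h φ‖ + D * (h ^ 2 / 4) := by
  have hF := (continuous_stepPrimitive hω h hφ).sub (continuous_const (y := stepCenter ω h φ))
  calc ∫ x in (0 : ℝ)..h, ‖stepPrimitive ω h φ x - stepCenter ω h φ‖
      ≤ ∫ y in (0 : ℝ)..h, (‖stepCenter ω h φ‖ + D * min y (h - y)) :=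
        integral_mono_on hh.le (hF.norm.intervalIntegrable _ _)
          (Continuous.intervalIntegrable (by fun_prop) _ _) fun y hy =>
            (norm_stepPrimitive_sub_stepCenter_le_add hω hω₁ hh hφ hI hy).trans <| by
              gcongr
              exact norm_integral_le_mul_min ((hφ.sub continuous_const).intervalIntegrable _ _)
                (integral_sub_mean hφ hI) hD hy
    _ = h * ‖stepCenter ω h φ‖ + D * (h ^ 2 / 4) := by
        rw [intervalIntegral.integral_add (by simp)
          (Continuous.intervalIntegrable (by fun_prop) _ _), intervalIntegral.integral_const_mul,
          integral_min_sub hh.le]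
        simp

theorem integral_norm_stepPrimitive_neg_one_le (hh : 0 < h) (hφ : Continuous φ)
    (hp : Function.Periodic φ h) :
    ∫ x in (0 : ℝ)..(2 * h), ‖stepPrimitive (-1) h φ x‖ ≤ h * ∫ t in (0 : ℝ)..h, ‖φ t‖ := by
  have integrable (a c : ℝ) := hφ.intervalIntegrable (μ := volume) a c
  have continuous_step : Continuous (stepPrimitive (-1) h φ) :=
    continuous_stepPrimitive (by simp) h hφ
  have integrable_step (a c : ℝ) :
      IntervalIntegrable (fun x => ‖stepPrimitive (-1) h φ x‖) volume a c :=
    continuous_step.norm.intervalIntegrable a c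
  have fold : ∫ x in h..(2 * h), ‖stepPrimitive (-1) h φ x‖ =
      ∫ x in (0 : ℝ)..h, ‖stepPrimitive (-1) h φ (x + h)‖ := by
    simp [integral_comp_add_right (fun x => ‖stepPrimitive (-1) h φ x‖) h, two_mul]
  have integrable_shift :
      IntervalIntegrable (fun x => ‖stepPrimitive (-1) h φ (x + h)‖) volume 0 h :=
    (continuous_step.comp (continuous_add_const h)).norm.intervalIntegrable 0 h
  have pointwise (x : ℝ) (hx : x ∈ Set.Icc 0 h) :
      ‖stepPrimitive (-1) h φ x‖ + ‖stepPrimitive (-1) h φ (x + h)‖ ≤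
        ∫ t in (0 : ℝ)..h, ‖φ t‖ := by
    rw [stepPrimitive_add (by simp) hh hφ hp, stepPrimitive_of_mem_Icc hx,
      ← integral_add_adjacent_intervals (integrable 0 x) (integrable x h),
      ← integral_add_adjacent_intervals (integrable 0 x).norm (integrable x h).norm,
      neg_one_mul, add_neg_cancel_comm]
    exact add_le_add (norm_integral_le_integral_norm hx.1) (norm_integral_le_integral_norm hx.2)
  rw [← integral_add_adjacent_intervals (integrable_step 0 h) (integrable_step h (2 * h)), fold,
    ← intervalIntegral.integral_add (integrable_step 0 h) integrable_shift]
  calc _ ≤ ∫ _ in (0 : ℝ)..h, ∫ t in (0 : ℝ)..h, ‖φ t‖ :=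
        integral_mono_on hh.le ((integrable_step 0 h).add integrable_shift) (by simp) pointwise
    _ = h * ∫ t in (0 : ℝ)..h, ‖φ t‖ := by simp

end StepPrimitive

section Constants

theorem mConst_le_norm_one_sub {b : ℕ} (hb : 2 ≤ b) {ω : ℂ} (hωb : ω ^ b = 1) (hω₁ : ω ≠ 1) :
    mConst b ≤ ‖1 - ω‖ := by
  have hb₀ : b ≠ 0 := by lia
  have : NeZero b := ⟨hb₀⟩
  have hbR : (0 : ℝ) < b := by positivity
  obtain ⟨i, hi, rfl⟩ : ∃ i < b, Complex.exp (2 * Real.pi * Complex.I * (i / b)) = ω :=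
    (Complex.mem_rootsOfUnity b (Units.ofPowEqOne ω b hωb hb₀)).1
      (Units.ext (by simp))
  have hi₁ : (1 : ℝ) ≤ i := by
    rw [Nat.one_le_cast, Nat.one_le_iff_ne_zero]
    rintro rfl
    simp at hω₁
  have hib : (i : ℝ) + 1 ≤ b := by exact_mod_cast hi
  have half_pi_div : Real.pi / b ≤ Real.pi := div_le_self Real.pi_pos.le (by linarith)
  have angle_mem : Real.pi * i / b ∈ Set.Icc (Real.pi / b) (Real.pi - Real.pi / b) := by
    refine ⟨by gcongr; exact le_mul_of_one_le_right Real.pi_pos.le hi₁, ?_⟩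
    rw [le_sub_iff_add_le, ← add_div, div_le_iff₀ hbR]
    nlinarith [Real.pi_pos]
  have sin_le := strictConcaveOn_sin_Icc.concaveOn.min_le_of_mem_Icc
    ⟨by positivity, half_pi_div⟩ ⟨by linarith, by linarith [div_pos Real.pi_pos hbR]⟩ angle_mem
  rw [Real.sin_pi_sub, min_self] at sin_le
  rw [norm_sub_rev, show 2 * Real.pi * Complex.I * (i / b) =
      Complex.I * (2 * (Real.pi * i / b) : ℝ) by push_cast; ring,
    Complex.norm_exp_I_mul_ofReal_sub_one, mul_div_cancel_left₀ _ two_ne_zero, mConst]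
  exact le_trans (by gcongr) (le_abs_self _)

theorem mConst_two : mConst 2 = 2 := by simp [mConst]

theorem four_div_le_mConst {b : ℕ} (hb : 2 ≤ b) : 4 / b ≤ mConst b := by
  have hbR : (2 : ℝ) ≤ b := by exact_mod_cast hb
  have jordan := Real.mul_le_sin (x := Real.pi / b) (by positivity) (by gcongr)
  rw [div_mul_div_cancel₀ Real.pi_ne_zero] at jordan
  rw [mConst]
  linarith [show (4 : ℝ) / b = 2 * (2 / b) by ring]

theorem mConst_pos {b : ℕ} (hb : 2 ≤ b) : 0 < mConst b :=
  (div_pos four_pos (Nat.cast_pos.2 (by lia))).trans_le (four_div_le_mConst hb)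

theorem mConst_le_two (b : ℕ) : mConst b ≤ 2 := by
  rw [mConst]
  linarith [Real.sin_le_one (Real.pi / b)]

theorem mConst_le_div (b : ℕ) : mConst b ≤ 2 * Real.pi / b := by
  rw [mConst, mul_div_assoc]
  gcongr
  exact Real.sin_le (by positivity)

theorem mConst_sq_le_three {b : ℕ} (hb : 3 ≤ b) : mConst b ^ 2 ≤ 3 := by
  have hb' : (3 : ℝ) ≤ b := by exact_mod_cast hb
  have sin_le : Real.sin (Real.pi / b) ≤ Real.sin (Real.pi / 3) :=
    Real.sin_le_sin_of_le_of_le_pi_div_two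
      (by linarith [Real.pi_pos, div_nonneg Real.pi_pos.le (Nat.cast_nonneg b)])
      (by gcongr; norm_num) (by gcongr)
  calc mConst b ^ 2 ≤ (2 * Real.sin (Real.pi / 3)) ^ 2 :=
        pow_le_pow_left₀ (mConst_pos (by lia)).le (by rw [mConst]; gcongr) 2
    _ = 3 := by simp [mul_pow, div_pow]; norm_num

theorem MConst_le_two (b : ℕ) : MConst b ≤ 2 := by
  rw [MConst]
  split_ifs
  · exact le_rfl
  · linarith [Real.sin_le_one ((b + 1) * Real.pi / (2 * b))]

theorem two_sub_MConst_le {b : ℕ} (hb : b ≠ 0) : 2 - MConst b ≤ 5 / 2 / b ^ 2 := by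
  rw [MConst]
  split_ifs
  · rw [sub_self]
    positivity
  · have angle : ((b : ℝ) + 1) * Real.pi / (2 * b) = Real.pi / (2 * b) + Real.pi / 2 := by
      field_simp
      ring
    have cos_ge := Real.one_sub_sq_div_two_le_cos (x := Real.pi / (2 * b))
    have pi_sq_le : Real.pi ^ 2 ≤ 10 := by nlinarith [Real.pi_lt_d2, Real.pi_pos]
    have sq_le : (Real.pi / (2 * b)) ^ 2 ≤ 5 / 2 / (b : ℝ) ^ 2 := by
      rw [div_pow, mul_pow, ← div_div]
      gcongr ?_ / _
      linarith
    rw [angle, Real.sin_add_pi_div_two]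
    linarith

/-- The constant `d` such that iterated primitives of Walsh functions deviate from their mean value
by at most `d` times their size, see `WalshPrimitive.norm_sub_mean_le`. For `b > 2` it is the
solution of `d = 1 + (m_b / 2) (1 + m_b d / 4)`. -/
noncomputable def devConst (b : ℕ) : ℝ :=
  if b = 2 then 1 else (1 + mConst b / 2) / (1 - mConst b ^ 2 / 8)

theorem devConst_eq {b : ℕ} (hb : 3 ≤ b) :
    devConst b = 1 + mConst b / 2 * (1 + mConst b / 4 * devConst b) := by
  have : 1 - mConst b ^ 2 / 8 ≠ 0 := by linarith [mConst_sq_le_three hb]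
  have : devConst b * (1 - mConst b ^ 2 / 8) = 1 + mConst b / 2 := by
    rw [devConst, if_neg (by lia), div_mul_cancel₀ _ this]
  linear_combination this

theorem devConst_le_one_add {b : ℕ} (hb : 3 ≤ b) :
    devConst b ≤ 1 + mConst b * (4 / 5 + 1.26 * (1 / b)) := by
  have hm : 0 < mConst b := mConst_pos (by lia)
  have hm₃ := mConst_sq_le_three hb
  have m_le : mConst b ≤ 6.3 * (1 / b) := (mConst_le_div b).trans <| by
    rw [mul_one_div]
    gcongr
    linarith [Real.pi_lt_d2]
  have devConst_eq : devConst b = 1 + mConst b * ((4 + mConst b) / (8 - mConst b ^ 2)) := by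
    have : 1 - mConst b ^ 2 / 8 ≠ 0 := by linarith
    have : 8 - mConst b ^ 2 ≠ 0 := by linarith
    rw [devConst, if_neg (by lia)]
    field_simp
    ring
  rw [devConst_eq]
  gcongr
  rw [div_le_iff₀ (by linarith)]
  nlinarith

/-- The factor of `m_b ^ (-i)` in the terms with `1 ≤ i ≤ α` of `C_{b,α,q}`. -/
noncomputable def lowerCoeff (b : ℕ) : ℝ :=
  if b = 2 then 1 else 1 + b * mConst b / (b - MConst b)

/-- The factor of `m_b ^ (-α)` in the last term of `C_{b,α,q}`. -/
noncomputable def topCoeff (b : ℕ) : ℝ :=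
  if b = 2 then 2 else MConst b + b * mConst b / (b - MConst b)

theorem one_add_devConst_le_topCoeff {b : ℕ} (hb : 2 ≤ b) : 1 + devConst b ≤ topCoeff b := by
  rcases hb.eq_or_lt with rfl | hb₃
  · norm_num [devConst, topCoeff]
  have hbR : (3 : ℝ) ≤ b := by exact_mod_cast hb₃
  have hm : 0 < mConst b := mConst_pos hb
  have hM₂ := MConst_le_two b
  have hbM : 0 < b - MConst b := by linarith
  have devConst_le := devConst_le_one_add hb₃
  have two_sub_le : 2 - MConst b ≤ mConst b * (0.625 * (1 / b)) := by
    calc 2 - MConst b ≤ 5 / 2 / b ^ 2 := two_sub_MConst_le (by lia)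
      _ = 4 / b * (0.625 * (1 / b)) := by field_simp; norm_num
      _ ≤ mConst b * (0.625 * (1 / b)) := by gcongr; exact four_div_le_mConst hb
  have M_ge : 1.72 ≤ MConst b := by
    have : (5 : ℝ) / 2 / b ^ 2 ≤ 5 / 2 / 3 ^ 2 := by gcongr
    linarith [two_sub_MConst_le (b := b) (by lia)]
  have quotient_ge : mConst b * (1 + 1.72 * (1 / b)) ≤ b * mConst b / (b - MConst b) := by
    rw [mul_comm (b : ℝ), mul_div_assoc]
    gcongr
    rw [le_div_iff₀ hbM]
    field_simp
    nlinarith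
  have inv_le : 1 / (b : ℝ) ≤ 1 / 3 := by gcongr
  rw [topCoeff, if_neg (by lia)]
  nlinarith

theorem devConst_le_lowerCoeff {b : ℕ} (hb : 2 ≤ b) : devConst b ≤ lowerCoeff b := by
  have := one_add_devConst_le_topCoeff hb
  rcases eq_or_ne b 2 with rfl | hb₂
  · simp [devConst, lowerCoeff]
  · rw [topCoeff, if_neg hb₂] at this
    rw [lowerCoeff, if_neg hb₂]
    linarith [MConst_le_two b]

theorem one_le_devConst {b : ℕ} (hb : 2 ≤ b) : 1 ≤ devConst b := by
  rcases hb.eq_or_lt with rfl | hb₃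
  · simp [devConst]
  · have := mConst_pos hb
    rw [devConst, if_neg (by lia), one_le_div (by linarith [mConst_sq_le_three hb₃])]
    linarith [sq_nonneg (mConst b)]

end Constants

section WalshPrimitives

/-- The length of the intervals on which the first `n` digits in base `b` are constant. -/
noncomputable def cellLength (b n : ℕ) : ℝ := ((b : ℝ) ^ n)⁻¹

theorem cellLength_pos {b : ℕ} (hb : b ≠ 0) (n : ℕ) : 0 < cellLength b n := by
  rw [cellLength]
  positivity

theorem cellLength_add (b i j : ℕ) : cellLength b (i + j) = cellLength b i * cellLength b j := by
  rw [cellLength, cellLength, cellLength, pow_add, mul_inv]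

theorem natCast_mul_cellLength_succ {b : ℕ} (hb : b ≠ 0) (n : ℕ) :
    b * cellLength b (n + 1) = cellLength b n := by
  rw [cellLength, cellLength, pow_succ']
  field_simp

theorem natCast_pow_mul_cellLength {b : ℕ} (hb : b ≠ 0) (n : ℕ) :
    ((b ^ n : ℕ) : ℝ) * cellLength b n = 1 := by
  rw [cellLength, Nat.cast_pow]
  exact mul_inv_cancel₀ (by positivity)

theorem integral_period_of_cellLength {E : Type*} [NormedAddCommGroup E] [NormedSpace ℝ E]
    {g : ℝ → E} {b n : ℕ} (hb : b ≠ 0) (hg : Continuous g)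
    (hp : Function.Periodic g (cellLength b n)) :
    ∫ x in (0 : ℝ)..cellLength b n, g x = cellLength b n • ∫ x in (0 : ℝ)..1, g x := by
  rw [integral_zero_one_of_periodic hp hg.intervalIntegrable (natCast_pow_mul_cellLength hb n),
    ← Nat.cast_smul_eq_nsmul ℝ, smul_smul, mul_comm, natCast_pow_mul_cellLength hb n, one_smul]

/-- `WalshPrimitive b n φ B` means that `φ` is obtained from the constant `1` by the operations
`stepPrimitive` that integrate the factors of a Walsh function one after the other. After `n` of
them remain to be integrated `φ` has period `b ^ (-n)`, and `B` is the size of `φ`: each step of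
width `b ^ (-j)` multiplies it by `b ^ (-j) / m_b`. -/
inductive WalshPrimitive (b : ℕ) : ℕ → (ℝ → ℂ) → ℝ → Prop
  | one (n : ℕ) : WalshPrimitive b n (fun _ => 1) 1
  | coarsen {n : ℕ} {φ : ℝ → ℂ} {B : ℝ} :
      WalshPrimitive b (n + 1) φ B → WalshPrimitive b n φ B
  | step {n : ℕ} {φ : ℝ → ℂ} {B : ℝ} {ω : ℂ} :
      WalshPrimitive b (n + 1) φ B → ω ^ b = 1 → ω ≠ 1 →
        WalshPrimitive b n (stepPrimitive ω (cellLength b (n + 1)) φ)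
          (cellLength b (n + 1) * B / mConst b)

namespace WalshPrimitive

variable {b n : ℕ} {φ : ℝ → ℂ} {B : ℝ}

theorem continuous (hb : b ≠ 0) (hφ : WalshPrimitive b n φ B) : Continuous φ := by
  induction hφ with
  | one => exact continuous_const
  | coarsen _ ih => exact ih
  | step _ hωb _ ih =>
    exact continuous_stepPrimitive (Complex.norm_eq_one_of_pow_eq_one hωb hb) _ ih

theorem periodic (hb : b ≠ 0) (hφ : WalshPrimitive b n φ B) :
    Function.Periodic φ (cellLength b n) := by
  induction hφ with
  | one => exact fun _ => rfl
  | coarsen _ ih =>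
    rw [← natCast_mul_cellLength_succ hb]
    exact ih.nat_mul b
  | step hφ hωb hω₁ ih =>
    have := periodic_stepPrimitive (Complex.norm_eq_one_of_pow_eq_one hωb hb) hω₁ hωb
      (cellLength_pos hb _) (hφ.continuous hb) ih
    rwa [natCast_mul_cellLength_succ hb] at this

theorem size_nonneg (hb : 2 ≤ b) (hφ : WalshPrimitive b n φ B) : 0 ≤ B := by
  induction hφ with
  | one => exact zero_le_one
  | coarsen _ ih => exact ih
  | step _ _ _ ih =>
    exact div_nonneg (mul_nonneg (cellLength_pos (by lia) _).le ih) (mConst_pos hb).le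

theorem integral_period (hb : b ≠ 0) (hφ : WalshPrimitive b n φ B) :
    ∫ x in (0 : ℝ)..cellLength b n, φ x = cellLength b n * ∫ x in (0 : ℝ)..1, φ x := by
  rw [integral_period_of_cellLength hb (hφ.continuous hb) (hφ.periodic hb), Complex.real_smul]

theorem integral_stepPrimitive {ω : ℂ} (hb : b ≠ 0) (hφ : WalshPrimitive b (n + 1) φ B)
    (hωb : ω ^ b = 1) (hω₁ : ω ≠ 1) :
    ∫ x in (0 : ℝ)..1, stepPrimitive ω (cellLength b (n + 1)) φ x =
      stepCenter ω (cellLength b (n + 1)) φ := by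
  have period := (hφ.step hωb hω₁).integral_period hb
  have length_ne : (cellLength b n : ℂ) ≠ 0 := by exact_mod_cast (cellLength_pos hb n).ne'
  have integral_step := WalshSobolev.integral_stepPrimitive
    (Complex.norm_eq_one_of_pow_eq_one hωb hb) hω₁ hωb (cellLength_pos hb (n + 1))
    (hφ.continuous hb) (hφ.periodic hb)
  rw [natCast_mul_cellLength_succ hb, ← Complex.ofReal_natCast, ← Complex.ofReal_mul,
    natCast_mul_cellLength_succ hb, period] at integral_step
  exact mul_left_cancel₀ length_ne integral_step

theorem norm_stepCenter_le {ω : ℂ} (hb : 2 ≤ b) (hφ : WalshPrimitive b (n + 1) φ B)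
    (hωb : ω ^ b = 1) (hω₁ : ω ≠ 1) (hB : ‖∫ x in (0 : ℝ)..1, φ x‖ ≤ B) :
    ‖stepCenter ω (cellLength b (n + 1)) φ‖ ≤ cellLength b (n + 1) * B / mConst b := by
  have := mConst_pos hb
  have length_nonneg := (cellLength_pos (b := b) (by lia) (n + 1)).le
  have := mConst_le_norm_one_sub hb hωb hω₁
  have := hφ.size_nonneg hb
  rw [stepCenter, hφ.integral_period (by lia), norm_div, norm_mul, Complex.norm_real,
    Real.norm_of_nonneg length_nonneg]
  gcongr

theorem norm_mean_le (hb : 2 ≤ b) (hφ : WalshPrimitive b n φ B) :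
    ‖∫ x in (0 : ℝ)..1, φ x‖ ≤ B := by
  induction hφ with
  | one => simp
  | coarsen _ ih => exact ih
  | step hφ hωb hω₁ ih =>
    rw [hφ.integral_stepPrimitive (by lia) hωb hω₁]
    exact hφ.norm_stepCenter_le hb hωb hω₁ ih

theorem norm_sub_mean_le_and_integral_norm_le (hφ : WalshPrimitive 2 n φ B) :
    (∀ x, ‖φ x - ∫ t in (0 : ℝ)..1, φ t‖ ≤ B) ∧ ∫ t in (0 : ℝ)..1, ‖φ t‖ ≤ B := by
  induction hφ with
  | one => simp
  | coarsen _ ih => exact ih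
  | @step n φ B ω hφ hωb hω₁ ih =>
    obtain rfl : ω = -1 := (sq_eq_one_iff.1 hωb).resolve_left hω₁
    have hF := hφ.step hωb hω₁
    have length_pos := cellLength_pos two_ne_zero (n + 1)
    have hφc := hφ.continuous two_ne_zero
    have hφp := hφ.periodic two_ne_zero
    have integral_norm_le : ∫ t in (0 : ℝ)..cellLength 2 (n + 1), ‖φ t‖ ≤
        cellLength 2 (n + 1) * B := by
      rw [integral_period_of_cellLength two_ne_zero hφc.norm (hφp.comp norm), smul_eq_mul]
      gcongr
      exact ih.2
    rw [hφ.integral_stepPrimitive two_ne_zero hωb hω₁, mConst_two]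
    constructor
    · intro x
      refine (norm_stepPrimitive_sub_stepCenter_le (by simp) hω₁ length_pos hφc hφp x).trans ?_
      rw [show ‖(1 : ℂ) - -1‖ = 2 by norm_num]
      gcongr
    · have := integral_norm_stepPrimitive_neg_one_le length_pos hφc hφp
      have double : 2 * cellLength 2 (n + 1) = cellLength 2 n := by
        exact_mod_cast natCast_mul_cellLength_succ two_ne_zero n
      rw [double, integral_period_of_cellLength two_ne_zero (hF.continuous two_ne_zero).norm
        ((hF.periodic two_ne_zero).comp norm), smul_eq_mul, ← double] at this
      nlinarith

theorem integral_norm_sub_mean_stepPrimitive_le {ω : ℂ} (hb : 2 ≤ b)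
    (hφ : WalshPrimitive b (n + 1) φ B) (hωb : ω ^ b = 1) (hω₁ : ω ≠ 1) {D : ℝ}
    (hD : ∀ x, ‖φ x - ∫ t in (0 : ℝ)..1, φ t‖ ≤ D) :
    ∫ x in (0 : ℝ)..1, ‖stepPrimitive ω (cellLength b (n + 1)) φ x -
        stepCenter ω (cellLength b (n + 1)) φ‖ ≤
      cellLength b (n + 1) * B / mConst b + cellLength b (n + 1) * D / 4 := by
  have hb₀ : b ≠ 0 := by lia
  have hω := Complex.norm_eq_one_of_pow_eq_one hωb hb₀
  have length_pos := cellLength_pos hb₀ (n + 1)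
  have hφc := hφ.continuous hb₀
  have over_period := integral_norm_stepPrimitive_sub_stepCenter_le hω hω₁ length_pos hφc
    (hφ.integral_period hb₀) hD
  rw [integral_period_of_cellLength (g := fun x => ‖stepPrimitive ω _ φ x - stepCenter ω _ φ‖) hb₀
    ((continuous_stepPrimitive hω _ hφc).sub continuous_const).norm
    (periodic_norm_stepPrimitive_sub_stepCenter hω hω₁ length_pos hφc (hφ.periodic hb₀)),
    smul_eq_mul] at over_period
  have center_le := hφ.norm_stepCenter_le hb hωb hω₁ (hφ.norm_mean_le hb)
  refine le_of_mul_le_mul_left (over_period.trans ?_) length_pos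
  nlinarith

theorem norm_stepPrimitive_sub_stepCenter_le {ω : ℂ} (hb : 2 ≤ b)
    (hφ : WalshPrimitive b (n + 1) φ B) (hωb : ω ^ b = 1) (hω₁ : ω ≠ 1) (x : ℝ) :
    ‖stepPrimitive ω (cellLength b (n + 1)) φ x - stepCenter ω (cellLength b (n + 1)) φ‖ ≤
      cellLength b (n + 1) * B / mConst b +
        cellLength b (n + 1) * (∫ t in (0 : ℝ)..1, ‖φ t - ∫ s in (0 : ℝ)..1, φ s‖) / 2 := by
  have hb₀ : b ≠ 0 := by lia
  have hφc := hφ.continuous hb₀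
  have hφp := hφ.periodic hb₀
  refine (norm_stepPrimitive_sub_stepCenter_le_of_mean (Complex.norm_eq_one_of_pow_eq_one hωb hb₀)
    hω₁ (cellLength_pos hb₀ _) hφc hφp (hφ.integral_period hb₀) x).trans ?_
  rw [integral_period_of_cellLength (g := fun t => ‖φ t - ∫ s in (0 : ℝ)..1, φ s‖) hb₀
    (hφc.sub continuous_const).norm
    (hφp.comp fun z => ‖z - ∫ s in (0 : ℝ)..1, φ s‖), smul_eq_mul]
  gcongr
  exact hφ.norm_stepCenter_le hb hωb hω₁ (hφ.norm_mean_le hb)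

theorem norm_sub_mean_le_and_integral_norm_sub_mean_le (hb : 3 ≤ b) (hφ : WalshPrimitive b n φ B) :
    (∀ x, ‖φ x - ∫ t in (0 : ℝ)..1, φ t‖ ≤ devConst b * B) ∧
      ∫ t in (0 : ℝ)..1, ‖φ t - ∫ s in (0 : ℝ)..1, φ s‖ ≤
        (1 + mConst b / 4 * devConst b) * B := by
  have hm := mConst_pos (b := b) (by lia)
  induction hφ with
  | one =>
    have := zero_le_one.trans (one_le_devConst (b := b) (by lia))
    simpa using ⟨this, by positivity⟩
  | coarsen _ ih => exact ih
  | @step n φ B ω hφ hωb hω₁ ih =>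
    have length_pos := cellLength_pos (b := b) (by lia) (n + 1)
    rw [hφ.integral_stepPrimitive (by lia) hωb hω₁]
    refine ⟨fun x => (hφ.norm_stepPrimitive_sub_stepCenter_le (by lia) hωb hω₁ x).trans ?_,
      (hφ.integral_norm_sub_mean_stepPrimitive_le (by lia) hωb hω₁ ih.1).trans_eq ?_⟩
    · calc _ ≤ cellLength b (n + 1) * B / mConst b +
            cellLength b (n + 1) * ((1 + mConst b / 4 * devConst b) * B) / 2 := by
            gcongr
            exact ih.2
        _ = (1 + mConst b / 2 * (1 + mConst b / 4 * devConst b)) *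
            (cellLength b (n + 1) * B / mConst b) := by field_simp
        _ = _ := by rw [← devConst_eq hb]
    · field_simp

theorem norm_sub_mean_le (hb : 2 ≤ b) (hφ : WalshPrimitive b n φ B) (x : ℝ) :
    ‖φ x - ∫ t in (0 : ℝ)..1, φ t‖ ≤ devConst b * B := by
  rcases hb.eq_or_lt with rfl | hb₃
  · simpa [devConst] using hφ.norm_sub_mean_le_and_integral_norm_le.1 x
  · exact (hφ.norm_sub_mean_le_and_integral_norm_sub_mean_le hb₃).1 x

end WalshPrimitive

end WalshPrimitives

section IntegrationByParts

variable {E : Type*} [NormedAddCommGroup E] [NormedSpace ℝ E] {g : ℝ → ℝ} {a c : ℝ}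

theorem deriv_ae_eq_derivWithin_Icc (g : ℝ → ℝ) (hac : a ≤ c) :
    deriv g =ᵐ[volume.restrict (Set.uIoc a c)] derivWithin g (Set.Icc a c) := by
  rw [Set.uIoc_of_le hac, Filter.EventuallyEq, ae_restrict_iff' measurableSet_Ioc]
  filter_upwards [Measure.ae_ne volume c] with x hx hxac
  rw [derivWithin_of_mem_nhds (Icc_mem_nhds hxac.1 (lt_of_le_of_ne hxac.2 hx))]

theorem intervalIntegrable_derivWithin_Icc (hac : a ≤ c)
    (hg : AbsolutelyContinuousOnInterval g a c) :
    IntervalIntegrable (derivWithin g (Set.Icc a c)) volume a c :=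
  hg.intervalIntegrable_deriv.congr_ae (deriv_ae_eq_derivWithin_Icc g hac)

theorem integral_mul_eq_neg_integral_derivWithin_mul {w : ℝ → ℝ} (hac : a ≤ c)
    (hg : AbsolutelyContinuousOnInterval g a c) (hw : IntervalIntegrable w volume a c)
    (hw₀ : ∫ t in a..c, w t = 0) :
    ∫ x in a..c, g x * w x =
      -∫ x in a..c, derivWithin g (Set.Icc a c) x * ∫ t in a..x, w t := by
  have by_parts := hg.integral_mul_deriv_eq_deriv_mul
    (hw.absolutelyContinuousOnInterval_intervalIntegral Set.left_mem_uIcc)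
  rw [hw₀, integral_same, mul_zero, mul_zero, sub_zero, zero_sub] at by_parts
  calc ∫ x in a..c, g x * w x = ∫ x in a..c, g x * deriv (fun x => ∫ t in a..x, w t) x := by
        refine integral_congr_ae ?_
        filter_upwards [hw.ae_hasDerivAt_integral] with x hx hxac
        rw [(hx (Set.uIoc_subset_uIcc hxac) a Set.left_mem_uIcc).deriv]
    _ = -∫ x in a..c, deriv g x * ∫ t in a..x, w t := by_parts
    _ = _ := by
        congr 1
        exact integral_congr_ae_restrict
          ((deriv_ae_eq_derivWithin_Icc g hac).mul (ae_eq_refl _))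

theorem integral_smul_eq_neg_integral_derivWithin_smul [CompleteSpace E] {w : ℝ → E} (hac : a ≤ c)
    (hg : AbsolutelyContinuousOnInterval g a c) (hw : IntervalIntegrable w volume a c)
    (hw₀ : ∫ t in a..c, w t = 0) :
    ∫ x in a..c, g x • w x =
      -∫ x in a..c, derivWithin g (Set.Icc a c) x • ∫ t in a..x, w t := by
  have integrable_left : IntervalIntegrable (fun x => g x • w x) volume a c :=
    hw.continuousOn_smul hg.continuousOn
  have integrable_right : IntervalIntegrable
      (fun x => derivWithin g (Set.Icc a c) x • ∫ t in a..x, w t) volume a c :=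
    (intervalIntegrable_derivWithin_Icc hac hg).smul_continuousOn
      (continuousOn_primitive_interval' hw Set.left_mem_uIcc)
  refine SeparatingDual.eq_iff_forall_dual_eq (R := ℝ).2 fun ℓ => ?_
  rw [map_neg, ← ℓ.intervalIntegral_comp_comm integrable_left,
    ← ℓ.intervalIntegral_comp_comm integrable_right]
  have real_case := integral_mul_eq_neg_integral_derivWithin_mul hac hg
    ⟨ℓ.integrable_comp hw.1, ℓ.integrable_comp hw.2⟩
    (by rw [ℓ.intervalIntegral_comp_comm hw, hw₀, map_zero])
  simp only [map_smul, smul_eq_mul] at real_case ⊢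
  rw [real_case]
  congr 1
  refine integral_congr fun x hx => ?_
  rw [← ℓ.intervalIntegral_comp_comm
    (hw.mono_set (Set.uIcc_subset_uIcc Set.left_mem_uIcc hx))]

end IntegrationByParts

section SmoothPart

/-- `g` belongs to the Sobolev space `W^{β,1}[0, 1]`; in contrast to `Sob`, the last derivative is
only required to be integrable. -/
structure IsSobolevOne (β : ℕ) (g : ℝ → ℝ) : Prop where
  absolutelyContinuous : ∀ i < β, AbsolutelyContinuousOnInterval (der i g) 0 1
  integrable : IntervalIntegrable (der β g) volume 0 1

/-- The bound for `|∫₀¹ g w|` that `β` integrations by parts produce, where `w` is a Walsh function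
times an iterated primitive: the weights are those of the mean values of `g, …, g^(β)` and of the
`L¹` norm of `g^(β)`. -/
noncomputable def derivBound (m T₁ T₂ : ℝ) (β : ℕ) (g : ℝ → ℝ) : ℝ :=
  (∑ i ∈ Finset.range (β + 1), T₁ / m ^ i * |∫ x in (0 : ℝ)..1, der i g x|) +
    T₂ / m ^ β * ∫ x in (0 : ℝ)..1, |der β g x|

variable {β : ℕ} {g : ℝ → ℝ}

theorem der_zero (f : ℝ → ℝ) : der 0 f = f := iteratedDerivWithin_zero

theorem der_succ (i : ℕ) (f : ℝ → ℝ) : der (i + 1) f = derivWithin (der i f) (Set.Icc 0 1) :=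
  iteratedDerivWithin_succ

theorem der_succ' (i : ℕ) (f : ℝ → ℝ) : der (i + 1) f = der i (derivWithin f (Set.Icc 0 1)) :=
  iteratedDerivWithin_succ'

namespace IsSobolevOne

theorem of_absolutelyContinuous {α : ℕ} (hα : 0 < α)
    (hg : ∀ i < α, AbsolutelyContinuousOnInterval (der i g) 0 1) : IsSobolevOne α g := by
  obtain ⟨β, rfl⟩ := Nat.exists_eq_add_of_le' hα
  refine ⟨hg, ?_⟩
  rw [der_succ]
  exact intervalIntegrable_derivWithin_Icc zero_le_one (hg β (by lia))

theorem derivWithin (hg : IsSobolevOne (β + 1) g) :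
    IsSobolevOne β (derivWithin g (Set.Icc 0 1)) where
  absolutelyContinuous i hi := by
    rw [← der_succ']
    exact hg.absolutelyContinuous (i + 1) (by lia)
  integrable := by
    rw [← der_succ']
    exact hg.integrable

theorem absolutelyContinuous_self (hg : IsSobolevOne (β + 1) g) :
    AbsolutelyContinuousOnInterval g 0 1 := by
  simpa only [der_zero] using hg.absolutelyContinuous 0 (by lia)

theorem intervalIntegrable (hg : IsSobolevOne β g) : IntervalIntegrable g volume 0 1 := by
  cases β with
  | zero => simpa only [der_zero] using hg.integrable
  | succ β => exact hg.absolutelyContinuous_self.continuousOn.intervalIntegrable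

end IsSobolevOne

theorem derivBound_zero (m T₁ T₂ : ℝ) (g : ℝ → ℝ) :
    derivBound m T₁ T₂ 0 g =
      T₁ * |∫ x in (0 : ℝ)..1, g x| + T₂ * ∫ x in (0 : ℝ)..1, |g x| := by
  simp [derivBound, der_zero]

theorem derivBound_succ (m T₁ T₂ : ℝ) (β : ℕ) (g : ℝ → ℝ) :
    derivBound m T₁ T₂ (β + 1) g = T₁ * |∫ x in (0 : ℝ)..1, g x| +
      derivBound m T₁ T₂ β (derivWithin g (Set.Icc 0 1)) / m := by
  simp only [derivBound, Finset.sum_range_succ' _ (β + 1), der_succ', der_zero, add_div,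
    Finset.sum_div, pow_succ, pow_zero, div_one, ← div_div, div_mul_eq_mul_div]
  ring

theorem mul_derivBound_one_le {m m' T T₁ T₂ : ℝ} (hm : 0 < m) (hm' : m ≤ m') (hT : 0 ≤ T)
    (hT₁ : T ≤ T₁) (hT₂ : T ≤ T₂) (β : ℕ) (g : ℝ → ℝ) :
    T * derivBound m' 1 1 β g ≤ derivBound m T₁ T₂ β g := by
  have hT₁₀ : 0 ≤ T₁ := hT.trans hT₁
  have hT₂₀ : 0 ≤ T₂ := hT.trans hT₂
  have integral_nonneg : 0 ≤ ∫ x in (0 : ℝ)..1, |der β g x| :=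
    integral_nonneg zero_le_one fun _ _ => abs_nonneg _
  simp only [derivBound, mul_add, Finset.mul_sum, ← mul_assoc, mul_one_div]
  gcongr

variable {E : Type*} [NormedAddCommGroup E] [NormedSpace ℝ E] {a c : ℝ}

theorem norm_integral_smul_le_mul_integral_abs (hac : a ≤ c) (hg : IntervalIntegrable g volume a c)
    {w : ℝ → E} {C : ℝ} (hw : ∀ x ∈ Set.Icc a c, ‖w x‖ ≤ C) :
    ‖∫ x in a..c, g x • w x‖ ≤ C * ∫ x in a..c, |g x| := by
  rw [← intervalIntegral.integral_const_mul]
  refine norm_integral_le_of_norm_le hac (.of_forall fun x hx => ?_) (hg.abs.const_mul C)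
  rw [norm_smul, Real.norm_eq_abs, mul_comm]
  exact mul_le_mul_of_nonneg_right (hw x ⟨hx.1.le, hx.2⟩) (abs_nonneg _)

theorem integral_smul_eq_smul_add_integral_smul_sub [CompleteSpace E]
    (hg : IntervalIntegrable g volume a c) {φ : ℝ → E} (hφ : Continuous φ) (v : E) :
    ∫ x in a..c, g x • φ x = (∫ x in a..c, g x) • v + ∫ x in a..c, g x • (φ x - v) := by
  rw [← intervalIntegral.integral_smul_const, ← intervalIntegral.integral_add
    (hg.smul_continuousOn continuousOn_const) (hg.smul_continuousOn (by fun_prop))]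
  simp only [← smul_add, add_sub_cancel]

theorem norm_sub_integral_le [CompleteSpace E] {Ψ : ℝ → E} (hΨ : Continuous Ψ) {v : E} {C : ℝ}
    (hC : ∀ y ∈ Set.Icc (0 : ℝ) 1, ‖v - Ψ y‖ ≤ C) : ‖v - ∫ y in (0 : ℝ)..1, Ψ y‖ ≤ C := by
  have : v - ∫ y in (0 : ℝ)..1, Ψ y = ∫ y in (0 : ℝ)..1, (v - Ψ y) := by
    rw [intervalIntegral.integral_sub intervalIntegrable_const (hΨ.intervalIntegrable 0 1)]
    simp
  rw [this]
  simpa using norm_integral_le_of_norm_le_const (a := 0) (b := 1) (C := C) fun y hy => by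
    rw [Set.uIoc_of_le zero_le_one] at hy
    exact hC y ⟨hy.1.le, hy.2⟩

theorem integral_sub_integral_zero_one [CompleteSpace E] {φ : ℝ → E} (hφ : Continuous φ) :
    ∫ t in (0 : ℝ)..1, (φ t - ∫ s in (0 : ℝ)..1, φ s) = 0 := by
  simp [intervalIntegral.integral_sub (hφ.intervalIntegrable 0 1) intervalIntegrable_const]

theorem norm_primitive_sub_mean_le_half [CompleteSpace E] {φ : ℝ → E} (hφ : Continuous φ) {C : ℝ}
    (hC : ∀ x ∈ Set.Icc (0 : ℝ) 1, ‖φ x - ∫ t in (0 : ℝ)..1, φ t‖ ≤ C) {Ψ : ℝ → E}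
    (hΨ : ∀ x, Ψ x = ∫ t in (0 : ℝ)..x, (φ t - ∫ s in (0 : ℝ)..1, φ s)) :
    ‖∫ x in (0 : ℝ)..1, Ψ x‖ ≤ C / 2 ∧
      ∀ x ∈ Set.Icc (0 : ℝ) 1, ‖Ψ x - ∫ t in (0 : ℝ)..1, Ψ t‖ ≤ C / 2 := by
  set ψ : ℝ → E := fun t => φ t - ∫ s in (0 : ℝ)..1, φ s
  have hψ : Continuous ψ := hφ.sub continuous_const
  have integral_norm_ψ : ∫ t in (0 : ℝ)..1, ‖ψ t‖ ≤ C := by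
    simpa using integral_mono_on zero_le_one (hψ.norm.intervalIntegrable 0 1)
      (intervalIntegrable_const (μ := volume) (c := C)) hC
  have oscillation_le : ∀ x ∈ Set.Icc (0 : ℝ) 1, ∀ y ∈ Set.Icc (0 : ℝ) 1, ‖Ψ x - Ψ y‖ ≤ C / 2 := by
    intro x hx y hy
    rw [hΨ, hΨ, integral_interval_sub_left (hψ.intervalIntegrable _ _)
      (hψ.intervalIntegrable _ _)]
    have := norm_integral_le_half_integral_norm zero_le_one (hψ.intervalIntegrable 0 1)
      (integral_sub_integral_zero_one hφ) hy hx
    linarith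
  have continuous_Ψ : Continuous Ψ := by
    rw [funext hΨ]
    exact continuous_primitive hψ.intervalIntegrable 0
  refine ⟨?_, fun x hx => norm_sub_integral_le continuous_Ψ (oscillation_le x hx)⟩
  simpa [hΨ 0] using norm_sub_integral_le continuous_Ψ (oscillation_le 0 (by simp))

theorem norm_integral_smul_le_mul_derivBound_two [CompleteSpace E] (hg : IsSobolevOne β g)
    {φ : ℝ → E} (hφ : Continuous φ) {C : ℝ} (mean_le : ‖∫ t in (0 : ℝ)..1, φ t‖ ≤ C)
    (dev_le : ∀ x ∈ Set.Icc (0 : ℝ) 1, ‖φ x - ∫ t in (0 : ℝ)..1, φ t‖ ≤ C) :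
    ‖∫ x in (0 : ℝ)..1, g x • φ x‖ ≤ C * derivBound 2 1 1 β g := by
  induction β generalizing g φ C with
  | zero =>
    rw [integral_smul_eq_smul_add_integral_smul_sub hg.intervalIntegrable hφ
      (∫ t in (0 : ℝ)..1, φ t), derivBound_zero, one_mul, one_mul, mul_add, mul_comm C]
    refine norm_add_le_of_le ?_
      (norm_integral_smul_le_mul_integral_abs zero_le_one hg.intervalIntegrable dev_le)
    rw [norm_smul, Real.norm_eq_abs]
    gcongr
  | succ β ih =>
    have hψ : Continuous fun t => φ t - ∫ s in (0 : ℝ)..1, φ s := hφ.sub continuous_const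
    have half := norm_primitive_sub_mean_le_half hφ dev_le (fun _ => rfl)
    rw [integral_smul_eq_smul_add_integral_smul_sub hg.intervalIntegrable hφ
      (∫ t in (0 : ℝ)..1, φ t), integral_smul_eq_neg_integral_derivWithin_smul zero_le_one
      hg.absolutelyContinuous_self (hψ.intervalIntegrable 0 1)
      (integral_sub_integral_zero_one hφ), derivBound_succ, one_mul, mul_add, mul_comm C,
      ← mul_comm_div]
    refine norm_add_le_of_le ?_ ?_
    · rw [norm_smul, Real.norm_eq_abs]
      gcongr
    · rw [norm_neg]
      exact ih hg.derivWithin (continuous_primitive hψ.intervalIntegrable 0) half.1 half.2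

end SmoothPart

section DigitWaves

/-- The step function `∏_{j < n} ω_j ^ ⌊b ^ (j + 1) x⌋`. If `ω_j ^ b = 1` for all `j`, the `j`-th
factor depends only on the digit `ξ_{j+1}` of `x`, and Walsh functions are of this form. -/
noncomputable def digitWave (b : ℕ) (ω : ℕ → ℂ) (n : ℕ) (x : ℝ) : ℂ :=
  ∏ j ∈ Finset.range n, ω j ^ ⌊x / cellLength b (j + 1)⌋

/-- The positions `j + 1 ≤ n` of the nonconstant factors of `digitWave b ω n`, in decreasing
order. -/
noncomputable def wavePositions (ω : ℕ → ℂ) (n : ℕ) : List ℕ :=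
  ((List.range n).reverse.filter (fun j => ω j ≠ 1)).map (· + 1)

theorem wavePositions_succ (ω : ℕ → ℂ) (n : ℕ) :
    wavePositions ω (n + 1) =
      if ω n = 1 then wavePositions ω n else (n + 1) :: wavePositions ω n := by
  rw [wavePositions, List.range_succ, List.reverse_concat, List.filter_cons]
  by_cases h : ω n = 1 <;> simp [h, wavePositions]

theorem digitWave_succ (b : ℕ) (ω : ℕ → ℂ) (n : ℕ) (x : ℝ) :
    digitWave b ω (n + 1) x = digitWave b ω n x * ω n ^ ⌊x / cellLength b (n + 1)⌋ :=
  Finset.prod_range_succ _ _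

theorem norm_digitWave (b : ℕ) {ω : ℕ → ℂ} (hω : ∀ j, ‖ω j‖ = 1) (n : ℕ) (x : ℝ) :
    ‖digitWave b ω n x‖ = 1 := by
  simp [digitWave, hω]

theorem measurable_digitWave (b : ℕ) (ω : ℕ → ℂ) (n : ℕ) : Measurable (digitWave b ω n) :=
  Finset.measurable_fun_prod _ fun _ _ => measurable_zpow_floor_div _ _

theorem intervalIntegrable_digitWave_mul (b : ℕ) {ω : ℕ → ℂ} (hω : ∀ j, ‖ω j‖ = 1) (n : ℕ)
    {w : ℝ → ℂ} {a c : ℝ} (hw : IntervalIntegrable w volume a c) :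
    IntervalIntegrable (fun t => digitWave b ω n t * w t) volume a c := by
  rw [intervalIntegrable_iff] at hw ⊢
  exact hw.bdd_mul (measurable_digitWave b ω n).aestronglyMeasurable
    (.of_forall fun x => (norm_digitWave b hω n x).le)

theorem digitWave_congr {b : ℕ} (hb : b ≠ 0) (ω : ℕ → ℂ) {n : ℕ} {x y : ℝ}
    (hxy : ⌊x / cellLength b n⌋ = ⌊y / cellLength b n⌋) :
    digitWave b ω n x = digitWave b ω n y := by
  refine Finset.prod_congr rfl fun j hj => ?_
  have coarser (t : ℝ) : ⌊t / cellLength b (j + 1)⌋ =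
      ⌊t / cellLength b n⌋ / ((b ^ (n - (j + 1)) : ℕ) : ℤ) := by
    have hbj : (b : ℝ) ^ n = b ^ (n - (j + 1)) * b ^ (j + 1) := by
      rw [← pow_add, Nat.sub_add_cancel (Finset.mem_range.1 hj)]
    rw [← Int.floor_div_natCast, cellLength, cellLength, hbj]
    push_cast
    field_simp
  rw [coarser, coarser, hxy]

theorem integral_mul_of_const_on_Ico {𝕜 : Type*} [RCLike 𝕜] {u w : ℝ → 𝕜} {a c : ℝ} {z : 𝕜}
    (hac : a ≤ c) (hu : ∀ t ∈ Set.Ico a c, u t = z) :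
    ∫ t in a..c, u t * w t = z * ∫ t in a..c, w t := by
  rw [← intervalIntegral.integral_const_mul, integral_of_le hac, integral_of_le hac,
    ← integral_Ico_eq_integral_Ioc, ← integral_Ico_eq_integral_Ioc]
  exact setIntegral_congr_fun measurableSet_Ico fun t ht => by simp only [hu t ht]

theorem integral_mul_of_floor_congr {𝕜 : Type*} [RCLike 𝕜] {u w : ℝ → 𝕜} {h : ℝ} (hh : 0 < h)
    (hu : ∀ x y, ⌊x / h⌋ = ⌊y / h⌋ → u x = u y) (hw : ∀ a c, IntervalIntegrable w volume a c)
    (huw : ∀ a c, IntervalIntegrable (fun t => u t * w t) volume a c)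
    (hw₀ : ∀ m : ℕ, ∫ t in (0 : ℝ)..(m * h), w t = 0) {x : ℝ} (hx : 0 ≤ x) :
    ∫ t in (0 : ℝ)..x, u t * w t = u x * ∫ t in (0 : ℝ)..x, w t := by
  have floor_eq (m : ℕ) {t : ℝ} (ht : t ∈ Set.Ico (m * h) ((m + 1) * h)) : ⌊t / h⌋ = m := by
    rw [Int.floor_eq_iff, le_div_iff₀ hh, div_lt_iff₀ hh]
    exact_mod_cast ht
  have on_cell (m : ℕ) {y z : ℝ} (hy : m * h ≤ y) (hyz : y ≤ (m + 1) * h)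
      (hz : z ∈ Set.Ico (m * h) ((m + 1) * h)) :
      ∫ t in (m * h)..y, u t * w t = u z * ∫ t in (0 : ℝ)..y, w t := by
    rw [← integral_add_adjacent_intervals (hw 0 (m * h)) (hw (m * h) y), hw₀, zero_add]
    exact integral_mul_of_const_on_Ico hy fun t ht =>
      hu t z ((floor_eq m ⟨ht.1, ht.2.trans_le hyz⟩).trans (floor_eq m hz).symm)
  have integral_eq_zero (m : ℕ) : ∫ t in (0 : ℝ)..(m * h), u t * w t = 0 := by
    induction m with
    | zero => simp
    | succ m ih =>
      have next := on_cell m (y := (m + 1 : ℕ) * h) (z := m * h) (by gcongr; simp) (by simp)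
        ⟨le_rfl, by gcongr; simp⟩
      rw [← integral_add_adjacent_intervals (huw 0 (m * h)) (huw _ _), ih, next, hw₀]
      simp
  have cell_mem : x ∈ Set.Ico (⌊x / h⌋₊ * h) ((⌊x / h⌋₊ + 1) * h) :=
    ⟨(le_div_iff₀ hh).1 (Nat.floor_le (by positivity)),
      (div_lt_iff₀ hh).1 (Nat.lt_floor_add_one _)⟩
  rw [← integral_add_adjacent_intervals (huw 0 (⌊x / h⌋₊ * h)) (huw _ x), integral_eq_zero,
    zero_add, on_cell _ cell_mem.1 cell_mem.2.le cell_mem]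

theorem stepPrimitive_natCast_mul_cellLength_eq_zero {b n : ℕ} {φ : ℝ → ℂ} {B : ℝ} {ω : ℂ}
    (hb : b ≠ 0) (hφ : WalshPrimitive b (n + 1) φ B) (hωb : ω ^ b = 1) (hω₁ : ω ≠ 1) (m : ℕ) :
    stepPrimitive ω (cellLength b (n + 1)) φ (m * cellLength b n) = 0 := by
  rw [((hφ.step hωb hω₁).periodic hb).nat_mul_eq m, stepPrimitive, integral_same]

variable {b : ℕ} {ω : ℕ → ℂ} {n : ℕ} {φ : ℝ → ℂ} {B : ℝ} {β : ℕ} {g : ℝ → ℝ}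

theorem integral_digitWave_succ_mul (hb : b ≠ 0) (hω : ∀ j, ω j ^ b = 1) (hωn : ω n ≠ 1)
    (hφ : WalshPrimitive b (n + 1) φ B) {x : ℝ} (hx : 0 ≤ x) :
    ∫ t in (0 : ℝ)..x, digitWave b ω (n + 1) t * φ t =
      digitWave b ω n x * stepPrimitive (ω n) (cellLength b (n + 1)) φ x := by
  have hω_norm (j : ℕ) : ‖ω j‖ = 1 := Complex.norm_eq_one_of_pow_eq_one (hω j) hb
  have integrable (a c : ℝ) := intervalIntegrable_zpow_floor_div_mul (hω_norm n)
    (cellLength b (n + 1)) ((hφ.continuous hb).intervalIntegrable (μ := volume) a c)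
  simp only [digitWave_succ, mul_assoc]
  exact integral_mul_of_floor_congr (cellLength_pos hb n) (fun _ _ => digitWave_congr hb ω)
    integrable (fun a c => intervalIntegrable_digitWave_mul b hω_norm n (integrable a c))
    (stepPrimitive_natCast_mul_cellLength_eq_zero hb hφ (hω n) hωn) hx

theorem integral_smul_digitWave_succ_mul (hb : b ≠ 0) (hω : ∀ j, ω j ^ b = 1) (hωn : ω n ≠ 1)
    (hφ : WalshPrimitive b (n + 1) φ B) (hg : AbsolutelyContinuousOnInterval g 0 1) :
    ∫ x in (0 : ℝ)..1, g x • (digitWave b ω (n + 1) x * φ x) =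
      -∫ x in (0 : ℝ)..1, derivWithin g (Set.Icc 0 1) x •
        (digitWave b ω n x * stepPrimitive (ω n) (cellLength b (n + 1)) φ x) := by
  have vanish : stepPrimitive (ω n) (cellLength b (n + 1)) φ 1 = 0 := by
    rw [← natCast_pow_mul_cellLength hb n]
    exact stepPrimitive_natCast_mul_cellLength_eq_zero hb hφ (hω n) hωn _
  rw [integral_smul_eq_neg_integral_derivWithin_smul zero_le_one hg
    (intervalIntegrable_digitWave_mul b (fun j => Complex.norm_eq_one_of_pow_eq_one (hω j) hb) _
      ((hφ.continuous hb).intervalIntegrable 0 1))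
    (by rw [integral_digitWave_succ_mul hb hω hωn hφ zero_le_one, vanish, mul_zero])]
  congr 1
  refine integral_congr fun x hx => ?_
  rw [Set.uIcc_of_le zero_le_one] at hx
  simp only [integral_digitWave_succ_mul hb hω hωn hφ hx.1]

theorem WalshPrimitive.norm_integral_smul_le (hb : 2 ≤ b) (hφ : WalshPrimitive b n φ B)
    (hg : IsSobolevOne β g) :
    ‖∫ x in (0 : ℝ)..1, g x • φ x‖ ≤
      B * derivBound (mConst b) (devConst b) (1 + devConst b) β g := by
  have hB := hφ.size_nonneg hb
  have hd := one_le_devConst hb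
  calc ‖∫ x in (0 : ℝ)..1, g x • φ x‖ ≤ devConst b * B * derivBound 2 1 1 β g :=
        norm_integral_smul_le_mul_derivBound_two hg (hφ.continuous (by lia))
          ((hφ.norm_mean_le hb).trans (le_mul_of_one_le_left hB hd))
          fun x _ => hφ.norm_sub_mean_le hb x
    _ = B * (devConst b * derivBound 2 1 1 β g) := by ring
    _ ≤ _ := by
        gcongr
        exact mul_derivBound_one_le (mConst_pos hb) (mConst_le_two b) (by linarith) le_rfl
          (by linarith) β g

theorem WalshPrimitive.norm_integral_smul_mul_le (hb : 2 ≤ b) (hφ : WalshPrimitive b n φ B)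
    (hg : IntervalIntegrable g volume 0 1) {u : ℝ → ℂ} (hu : ∀ x, ‖u x‖ = 1) :
    ‖∫ x in (0 : ℝ)..1, g x • (u x * φ x)‖ ≤
      B * derivBound (mConst b) (devConst b) (1 + devConst b) 0 g := by
  have hB := hφ.size_nonneg hb
  have hd := one_le_devConst hb
  have norm_le (x : ℝ) : ‖u x * φ x‖ ≤ B * (1 + devConst b) := by
    rw [norm_mul, hu, one_mul, mul_one_add, mul_comm B (devConst b)]
    simpa using norm_add_le_of_le (hφ.norm_mean_le hb) (hφ.norm_sub_mean_le hb x)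
  calc ‖∫ x in (0 : ℝ)..1, g x • (u x * φ x)‖
      ≤ B * (1 + devConst b) * ∫ x in (0 : ℝ)..1, |g x| :=
        norm_integral_smul_le_mul_integral_abs zero_le_one hg fun x _ => norm_le x
    _ ≤ B * (devConst b * |∫ x in (0 : ℝ)..1, g x| +
          (1 + devConst b) * ∫ x in (0 : ℝ)..1, |g x|) := by
        rw [mul_assoc]
        gcongr
        exact le_add_of_nonneg_left (by positivity)
    _ = _ := by rw [derivBound_zero]

theorem norm_integral_smul_digitWave_mul_le (hb : 2 ≤ b) (hω : ∀ j, ω j ^ b = 1)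
    (hφ : WalshPrimitive b n φ B) (hg : IsSobolevOne β g) :
    ‖∫ x in (0 : ℝ)..1, g x • (digitWave b ω n x * φ x)‖ ≤
      cellLength b ((wavePositions ω n).take β).sum * B *
        derivBound (mConst b) (devConst b) (1 + devConst b) β g := by
  have hb₀ : b ≠ 0 := by lia
  induction n generalizing β g φ B with
  | zero => simpa [digitWave, wavePositions, cellLength] using hφ.norm_integral_smul_le hb hg
  | succ n ih =>
    rw [wavePositions_succ]
    split_ifs with hωn
    · simpa [digitWave_succ, hωn] using ih hφ.coarsen hg
    cases β with
    | zero =>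
      simpa [cellLength] using hφ.norm_integral_smul_mul_le hb hg.intervalIntegrable
        (norm_digitWave b (fun j => Complex.norm_eq_one_of_pow_eq_one (hω j) hb₀) (n + 1))
    | succ β =>
      have hB := hφ.size_nonneg hb
      have hd := one_le_devConst hb
      have hL (i : ℕ) := cellLength_pos hb₀ i
      rw [integral_smul_digitWave_succ_mul hb₀ hω hωn hφ hg.absolutelyContinuous_self, norm_neg]
      refine (ih (hφ.step (hω n) hωn) hg.derivWithin).trans ?_
      rw [derivBound_succ, List.take_succ_cons, List.sum_cons, cellLength_add b (n + 1)]
      calc _ = cellLength b (n + 1) * cellLength b ((wavePositions ω n).take β).sum * B *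
            (derivBound (mConst b) (devConst b) (1 + devConst b) β
              (derivWithin g (Set.Icc 0 1)) / mConst b) := by ring
        _ ≤ _ := by
          have := hL (n + 1)
          have := hL ((wavePositions ω n).take β).sum
          gcongr
          exact le_add_of_nonneg_left (by positivity)

end DigitWaves

section WalshCoefficients

/-- The root of unity `conj ω_b ^ κ` with `κ` the coefficient of `b ^ j` in `k`: the conjugate of
`wal b k` is the digit wave of these numbers. -/
noncomputable def digitRoot (b k j : ℕ) : ℂ :=
  (starRingEnd ℂ) (Complex.exp (2 * Real.pi * Complex.I / b)) ^ natDigit b k j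

theorem isPrimitiveRoot_conj_exp {b : ℕ} (hb : b ≠ 0) :
    IsPrimitiveRoot ((starRingEnd ℂ) (Complex.exp (2 * Real.pi * Complex.I / b))) b :=
  (Complex.isPrimitiveRoot_exp b hb).map_of_injective (starRingEnd ℂ).injective

theorem digitRoot_pow_eq_one {b : ℕ} (hb : b ≠ 0) (k j : ℕ) : digitRoot b k j ^ b = 1 := by
  rw [digitRoot, pow_right_comm, (isPrimitiveRoot_conj_exp hb).pow_eq_one, one_pow]

theorem digitRoot_eq_one_iff {b : ℕ} (hb : 2 ≤ b) {k j : ℕ} :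
    digitRoot b k j = 1 ↔ natDigit b k j = 0 := by
  refine ⟨fun h => ?_, fun h => by rw [digitRoot, h, pow_zero]⟩
  by_contra digit_ne_zero
  refine (isPrimitiveRoot_conj_exp (by lia)).pow_ne_one_of_pos_of_lt digit_ne_zero ?_ h
  rw [natDigit, Nat.getD_digits _ _ hb]
  exact Nat.mod_lt _ (by lia)

theorem natDigit_ne_zero_of_length_eq {b k n : ℕ} (hk : k ≠ 0)
    (hn : (Nat.digits b k).length = n + 1) : natDigit b k n ≠ 0 := by
  have last_ne_zero := Nat.getLast_digit_ne_zero b hk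
  rw [List.getLast_eq_getElem] at last_ne_zero
  rw [natDigit, List.getD_eq_getElem _ _ (by lia)]
  simpa only [hn, Nat.add_sub_cancel] using last_ne_zero

theorem positions_eq_wavePositions {b : ℕ} (hb : 2 ≤ b) (k : ℕ) :
    positions b k = wavePositions (digitRoot b k) (Nat.digits b k).length := by
  simp only [positions, wavePositions, ne_eq, digitRoot_eq_one_iff hb]

theorem mu_succ_eq {b k n : ℕ} (hb : 2 ≤ b) (hk : k ≠ 0) (hn : (Nat.digits b k).length = n + 1)
    (β : ℕ) : mu b (β + 1) k = n + 1 + ((wavePositions (digitRoot b k) n).take β).sum := by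
  have digitRoot_ne_one : digitRoot b k n ≠ 1 :=
    (digitRoot_eq_one_iff hb).not.2 (natDigit_ne_zero_of_length_eq hk hn)
  rw [mu, positions_eq_wavePositions hb, hn, wavePositions_succ, if_neg digitRoot_ne_one,
    List.take_succ_cons, List.sum_cons]

theorem conj_wal_eq_digitWave {b : ℕ} [NeZero b] (k : ℕ) {x : ℝ} (hx : 0 ≤ x) :
    (starRingEnd ℂ) (wal b k x) = digitWave b (digitRoot b k) (Nat.digits b k).length x := by
  rw [wal, map_pow, ← Finset.prod_pow_eq_pow_sum, digitWave]
  refine Finset.prod_congr rfl fun j _ => ?_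
  rw [pow_mul, ← digitRoot, Real.digits, Fin.val_ofNat, cellLength, div_inv_eq_mul,
    ← Int.natCast_floor_eq_floor (by positivity), zpow_natCast]
  exact (pow_eq_pow_mod _ (digitRoot_pow_eq_one (NeZero.ne b) k j)).symm

theorem walshCoeff_eq_integral_digitWave (b : ℕ) [NeZero b] (f : ℝ → ℝ) (k : ℕ) :
    walshCoeff b f k =
      ∫ x in (0 : ℝ)..1, f x • digitWave b (digitRoot b k) (Nat.digits b k).length x := by
  rw [walshCoeff, integral_of_le zero_le_one, ← integral_Ico_eq_integral_Ioc]
  exact setIntegral_congr_fun measurableSet_Ico fun x hx => by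
    simp only [conj_wal_eq_digitWave k hx.1, Complex.real_smul]

theorem norm_walshCoeff_le {b : ℕ} [NeZero b] (hb : 2 ≤ b) {k : ℕ} (hk : 0 < k) {β : ℕ} {f : ℝ → ℝ}
    (hf : IsSobolevOne (β + 1) f) :
    ‖walshCoeff b f k‖ ≤ (b : ℝ) ^ (-(mu b (β + 1) k : ℤ)) *
      (derivBound (mConst b) (devConst b) (1 + devConst b) β (derivWithin f (Set.Icc 0 1)) /
        mConst b) := by
  obtain ⟨n, hn⟩ : ∃ n, (Nat.digits b k).length = n + 1 :=
    Nat.exists_eq_succ_of_ne_zero (by simpa [Nat.digits_ne_nil_iff_ne_zero] using hk.ne')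
  have hω := digitRoot_pow_eq_one (NeZero.ne b) k
  have hωn : digitRoot b k n ≠ 1 :=
    (digitRoot_eq_one_iff hb).not.2 (natDigit_ne_zero_of_length_eq hk.ne' hn)
  have one := WalshPrimitive.one (b := b) (n + 1)
  have integrate_by_parts := integral_smul_digitWave_succ_mul (NeZero.ne b) hω hωn one
    hf.absolutelyContinuous_self
  simp only [mul_one] at integrate_by_parts
  rw [walshCoeff_eq_integral_digitWave, hn, integrate_by_parts, norm_neg, mu_succ_eq hb hk.ne' hn,
    zpow_neg, zpow_natCast, ← cellLength, cellLength_add b (n + 1)]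
  have le := norm_integral_smul_digitWave_mul_le hb hω (one.step (hω n) hωn) hf.derivWithin
  exact le.trans_eq (by ring)

end WalshCoefficients

section Hoelder

theorem sum_mul_add_mul_rpow_le {ι : Type*} (s : Finset ι) {p q : ℝ} (hpq : p.HolderConjugate q)
    (c A : ι → ℝ≥0∞) (c' N : ℝ≥0∞) :
    ∑ i ∈ s, c i * A i + c' * N ^ (1 / p) ≤
      (∑ i ∈ s, c i ^ q + c' ^ q) ^ (1 / q) * (∑ i ∈ s, A i ^ p + N) ^ (1 / p) := by
  have hoelder := ENNReal.inner_le_Lp_mul_Lq (Finset.insertNone s)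
    (fun o => o.elim c' c) (fun o => o.elim (N ^ (1 / p)) A) hpq.symm
  simp only [Finset.sum_insertNone, Option.elim] at hoelder
  rwa [← ENNReal.rpow_mul, one_div_mul_cancel hpq.ne_zero, ENNReal.rpow_one, add_comm,
    add_comm (c' ^ q), add_comm N] at hoelder

theorem lintegral_le_lintegral_rpow {Ω : Type*} [MeasurableSpace Ω] {μ : Measure Ω}
    [IsProbabilityMeasure μ] {g : Ω → ℝ≥0∞} (hg : AEMeasurable g μ) {p q : ℝ}
    (hpq : p.HolderConjugate q) : ∫⁻ x, g x ∂μ ≤ (∫⁻ x, g x ^ p ∂μ) ^ (1 / p) := by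
  simpa using ENNReal.lintegral_mul_le_Lp_mul_Lq μ hpq hg (aemeasurable_const (b := 1))

theorem Icc_one_subset_range_succ (α : ℕ) : Finset.Icc 1 α ⊆ Finset.range (α + 1) := fun i hi => by
  simp only [Finset.mem_Icc, Finset.mem_range] at hi ⊢
  lia

/-- The `ℓ^q` norm of the finite sequence `c 1, …, c α, c'`. -/
noncomputable def coeffNorm (c : ℕ → ℝ) (c' : ℝ) (α : ℕ) (q : ℝ≥0∞) : ℝ :=
  if q = ∞ then max (⨆ i : Finset.Icc 1 α, c i) c'
  else (∑ i ∈ Finset.Icc 1 α, c i ^ q.toReal + c' ^ q.toReal) ^ (1 / q.toReal)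

variable {α : ℕ} {c : ℕ → ℝ} {c' : ℝ}

theorem ofReal_coeffNorm (hc : ∀ i, 0 ≤ c i) (hc' : 0 ≤ c') {q : ℝ≥0∞} (hq : q ≠ ∞) :
    ENNReal.ofReal (coeffNorm c c' α q) =
      (∑ i ∈ Finset.Icc 1 α, ENNReal.ofReal (c i) ^ q.toReal + ENNReal.ofReal c' ^ q.toReal) ^
        (1 / q.toReal) := by
  have pow_nonneg (i : ℕ) : 0 ≤ c i ^ q.toReal := Real.rpow_nonneg (hc i) _
  have sum_nonneg : 0 ≤ ∑ i ∈ Finset.Icc 1 α, c i ^ q.toReal :=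
    Finset.sum_nonneg fun i _ => pow_nonneg i
  have last_nonneg : 0 ≤ c' ^ q.toReal := Real.rpow_nonneg hc' _
  rw [coeffNorm, if_neg hq, ← ENNReal.ofReal_rpow_of_nonneg (by positivity) (by positivity),
    ENNReal.ofReal_add sum_nonneg last_nonneg, ENNReal.ofReal_sum_of_nonneg fun i _ => pow_nonneg i,
    ← ENNReal.ofReal_rpow_of_nonneg hc' ENNReal.toReal_nonneg]
  simp only [← ENNReal.ofReal_rpow_of_nonneg (hc _) ENNReal.toReal_nonneg]

variable {f : ℝ → ℝ}

theorem sum_mul_enorm_integral_der_le_coeffNorm_one_mul_sobNorm_top (hc : ∀ i, 0 ≤ c i)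
    (hc' : 0 ≤ c') :
    ∑ i ∈ Finset.Icc 1 α, ENNReal.ofReal (c i) * ‖∫ x in (0 : ℝ)..1, der i f x‖ₑ +
        ENNReal.ofReal c' * ∫⁻ x in Set.Icc (0 : ℝ) 1, ‖der α f x‖ₑ ≤
      ENNReal.ofReal (coeffNorm c c' α 1) * sobNorm ∞ α f := by
  rw [ofReal_coeffNorm hc hc' ENNReal.one_ne_top, sobNorm, if_pos rfl]
  simp only [ENNReal.toReal_one, ENNReal.rpow_one, div_one, add_mul, Finset.sum_mul]
  gcongr with i hi
  · exact (Finset.le_sup (f := fun i => ‖∫ x in (0 : ℝ)..1, der i f x‖ₑ)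
      (Icc_one_subset_range_succ α hi)).trans (le_max_left _ _)
  · refine le_trans ?_ (le_max_right _ _)
    simpa using lintegral_mono_ae
      (ENNReal.ae_le_essSup (μ := volume.restrict (Set.Icc (0 : ℝ) 1)) fun x => ‖der α f x‖ₑ)

theorem sum_mul_enorm_integral_der_le_coeffNorm_top_mul_sobNorm_one :
    ∑ i ∈ Finset.Icc 1 α, ENNReal.ofReal (c i) * ‖∫ x in (0 : ℝ)..1, der i f x‖ₑ +
        ENNReal.ofReal c' * ∫⁻ x in Set.Icc (0 : ℝ) 1, ‖der α f x‖ₑ ≤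
      ENNReal.ofReal (coeffNorm c c' α ∞) * sobNorm 1 α f := by
  rw [coeffNorm, if_pos rfl, sobNorm, if_neg ENNReal.one_ne_top]
  simp only [ENNReal.toReal_one, ENNReal.rpow_one, div_one, mul_add, Finset.mul_sum]
  refine add_le_add ((Finset.sum_le_sum fun i hi => ?_).trans
    (Finset.sum_le_sum_of_subset (Icc_one_subset_range_succ α))) ?_
  · gcongr
    exact le_max_of_le_left (le_ciSup (f := fun i : Finset.Icc 1 α => c i)
      (Set.finite_range _).bddAbove ⟨i, hi⟩)
  · gcongr
    exact le_max_right _ _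

theorem sum_mul_enorm_integral_der_le_coeffNorm_mul_sobNorm (hc : ∀ i, 0 ≤ c i) (hc' : 0 ≤ c')
    {p q : ℝ≥0∞} (hpq : p.HolderConjugate q)
    (hf : AEStronglyMeasurable (der α f) (volume.restrict (Set.Icc 0 1))) :
    ∑ i ∈ Finset.Icc 1 α, ENNReal.ofReal (c i) * ‖∫ x in (0 : ℝ)..1, der i f x‖ₑ +
        ENNReal.ofReal c' * ∫⁻ x in Set.Icc (0 : ℝ) 1, ‖der α f x‖ₑ ≤
      ENNReal.ofReal (coeffNorm c c' α q) * sobNorm p α f := by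
  by_cases hp : p = ∞
  · obtain rfl : q = 1 := by simpa [hp] using hpq.inv_add_inv_eq_inv
    rw [hp]
    exact sum_mul_enorm_integral_der_le_coeffNorm_one_mul_sobNorm_top hc hc'
  by_cases hq : q = ∞
  · obtain rfl : p = 1 := by simpa [hq] using hpq.inv_add_inv_eq_inv
    rw [hq]
    exact sum_mul_enorm_integral_der_le_coeffNorm_top_mul_sobNorm_one
  have hpq' := ENNReal.HolderConjugate.toReal_of_ne_top (p := p) (q := q) hp hq
  have : IsProbabilityMeasure (volume.restrict (Set.Icc (0 : ℝ) 1)) := ⟨by simp⟩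
  rw [ofReal_coeffNorm hc hc' hq, sobNorm, if_neg hp]
  calc _ ≤ ∑ i ∈ Finset.Icc 1 α, ENNReal.ofReal (c i) * ‖∫ x in (0 : ℝ)..1, der i f x‖ₑ +
        ENNReal.ofReal c' *
          (∫⁻ x in Set.Icc (0 : ℝ) 1, ‖der α f x‖ₑ ^ p.toReal) ^ (1 / p.toReal) := by
        gcongr
        exact lintegral_le_lintegral_rpow hf.enorm hpq'
    _ ≤ _ := sum_mul_add_mul_rpow_le _ hpq' _ _ _ _
    _ ≤ _ := by
        gcongr
        exact Icc_one_subset_range_succ α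

end Hoelder

section Assembly

theorem boundConstDyadic_eq_coeffNorm (α : ℕ) (q : ℝ≥0∞) :
    boundConstDyadic α q = coeffNorm (fun i => 1 / 2 ^ i) (2 / 2 ^ α) α q := by
  have lower (i : ℕ) : (2 : ℝ) ^ (-(i : ℝ)) = 1 / 2 ^ i := by
    rw [Real.rpow_neg two_pos.le, Real.rpow_natCast, one_div]
  have top : (2 : ℝ) ^ (-((α : ℝ) - 1)) = 2 / 2 ^ α := by
    rw [neg_sub, Real.rpow_sub two_pos, Real.rpow_natCast, Real.rpow_one]
  simp only [boundConstDyadic, coeffNorm, ← neg_mul, Real.rpow_mul two_pos.le, lower, top]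

theorem one_div_rpow_mul_mul_rpow {m T : ℝ} (hm : 0 ≤ m) (hT : 0 ≤ T) (i : ℕ) (r : ℝ) :
    1 / m ^ (i * r) * T ^ r = (T / m ^ i) ^ r := by
  rw [Real.div_rpow hT (by positivity), Real.rpow_mul hm, Real.rpow_natCast, one_div_mul_eq_div]

theorem lowerCoeff_nonneg {b : ℕ} (hb : 2 ≤ b) : 0 ≤ lowerCoeff b := by
  linarith [one_le_devConst hb, devConst_le_lowerCoeff hb]

theorem topCoeff_nonneg {b : ℕ} (hb : 2 ≤ b) : 0 ≤ topCoeff b := by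
  linarith [one_le_devConst hb, one_add_devConst_le_topCoeff hb]

theorem boundConst_eq_coeffNorm {b : ℕ} (hb : 2 ≤ b) (α : ℕ) (q : ℝ≥0∞) :
    boundConst b α q =
      coeffNorm (fun i => lowerCoeff b / mConst b ^ i) (topCoeff b / mConst b ^ α) α q := by
  have lower_nonneg := lowerCoeff_nonneg hb
  have top_nonneg := topCoeff_nonneg hb
  rw [boundConst]
  split_ifs with hb₂
  · simp only [boundConstDyadic_eq_coeffNorm, lowerCoeff, topCoeff, hb₂, if_true, mConst_two]
  · rw [lowerCoeff, if_neg hb₂] at lower_nonneg ⊢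
    rw [topCoeff, if_neg hb₂] at top_nonneg ⊢
    simp only [boundConstNonDyadic, coeffNorm, one_div_mul_eq_div,
      one_div_rpow_mul_mul_rpow (mConst_pos hb).le lower_nonneg,
      one_div_rpow_mul_mul_rpow (mConst_pos hb).le top_nonneg]

theorem derivBound_mono {m T₁ T₂ T₁' T₂' : ℝ} (hm : 0 ≤ m) (hT₁ : T₁ ≤ T₁') (hT₂ : T₂ ≤ T₂')
    (β : ℕ) (g : ℝ → ℝ) : derivBound m T₁ T₂ β g ≤ derivBound m T₁' T₂' β g := by
  have integral_nonneg : 0 ≤ ∫ x in (0 : ℝ)..1, |der β g x| :=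
    integral_nonneg zero_le_one fun _ _ => abs_nonneg _
  simp only [derivBound]
  gcongr

theorem derivBound_derivWithin_div (m T₁ T₂ : ℝ) (β : ℕ) (f : ℝ → ℝ) :
    derivBound m T₁ T₂ β (derivWithin f (Set.Icc 0 1)) / m =
      ∑ i ∈ Finset.Icc 1 (β + 1), T₁ / m ^ i * |∫ x in (0 : ℝ)..1, der i f x| +
        T₂ / m ^ (β + 1) * ∫ x in (0 : ℝ)..1, |der (β + 1) f x| := by
  have sum_shift := Finset.sum_Ico_add'
    (fun i => T₁ / m ^ i * |∫ x in (0 : ℝ)..1, der i f x|) 0 (β + 1) 1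
  rw [zero_add, ← Finset.range_eq_Ico, Finset.Ico_add_one_right_eq_Icc] at sum_shift
  rw [← sum_shift]
  simp only [derivBound, ← der_succ', add_div, Finset.sum_div, pow_succ, ← div_div,
    div_mul_eq_mul_div]

theorem ofReal_derivBound_derivWithin_div {m T₁ T₂ : ℝ} (hm : 0 < m) (h₁ : 0 ≤ T₁) (h₂ : 0 ≤ T₂)
    {β : ℕ} {f : ℝ → ℝ} (hf : IntervalIntegrable (der (β + 1) f) volume 0 1) :
    ENNReal.ofReal (derivBound m T₁ T₂ β (derivWithin f (Set.Icc 0 1)) / m) =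
      ∑ i ∈ Finset.Icc 1 (β + 1), ENNReal.ofReal (T₁ / m ^ i) * ‖∫ x in (0 : ℝ)..1, der i f x‖ₑ +
        ENNReal.ofReal (T₂ / m ^ (β + 1)) * ∫⁻ x in Set.Icc (0 : ℝ) 1, ‖der (β + 1) f x‖ₑ := by
  have lintegral_eq : ∫⁻ x in Set.Icc (0 : ℝ) 1, ‖der (β + 1) f x‖ₑ =
      ENNReal.ofReal (∫ x in (0 : ℝ)..1, |der (β + 1) f x|) := by
    simp only [← Real.norm_eq_abs]
    rw [integral_of_le zero_le_one, ofReal_integral_norm_eq_lintegral_enorm hf.1]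
    exact setLIntegral_congr Ioc_ae_eq_Icc.symm
  have integral_nonneg : 0 ≤ ∫ x in (0 : ℝ)..1, |der (β + 1) f x| :=
    integral_nonneg zero_le_one fun _ _ => abs_nonneg _
  rw [derivBound_derivWithin_div, lintegral_eq,
    ENNReal.ofReal_add (Finset.sum_nonneg fun i _ => by positivity) (by positivity),
    ENNReal.ofReal_sum_of_nonneg fun i _ => by positivity, ENNReal.ofReal_mul (by positivity)]
  simp only [ENNReal.ofReal_mul (div_nonneg h₁ (pow_nonneg hm.le _)), ← Real.norm_eq_abs,
    ofReal_norm]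

theorem enorm_walshCoeff_le {b : ℕ} [NeZero b] (hb : 2 ≤ b) {k : ℕ} (hk : 0 < k) {β : ℕ} {f : ℝ → ℝ}
    (hf : IsSobolevOne (β + 1) f) {p q : ℝ≥0∞} (hpq : p.HolderConjugate q) :
    ‖walshCoeff b f k‖ₑ ≤ ENNReal.ofReal ((b : ℝ) ^ (-(mu b (β + 1) k : ℤ)) *
      boundConst b (β + 1) q) * sobNorm p (β + 1) f := by
  have hm := mConst_pos hb
  have h₁ := lowerCoeff_nonneg hb
  have h₂ := topCoeff_nonneg hb
  have measurable : AEStronglyMeasurable (der (β + 1) f) (volume.restrict (Set.Icc 0 1)) := by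
    rw [← restrict_Ioc_eq_restrict_Icc]
    exact hf.integrable.1.aestronglyMeasurable
  have derivBound_le := derivBound_mono hm.le (devConst_le_lowerCoeff hb)
    (one_add_devConst_le_topCoeff hb) β (derivWithin f (Set.Icc 0 1))
  rw [← ofReal_norm, ENNReal.ofReal_mul (by positivity), mul_assoc, boundConst_eq_coeffNorm hb]
  refine (ENNReal.ofReal_le_ofReal (norm_walshCoeff_le hb hk hf)).trans ?_
  rw [ENNReal.ofReal_mul (by positivity)]
  gcongr
  calc _ ≤ ENNReal.ofReal (derivBound (mConst b) (lowerCoeff b) (topCoeff b) β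
        (derivWithin f (Set.Icc 0 1)) / mConst b) := by gcongr
    _ = _ := ofReal_derivBound_derivWithin_div hm h₁ h₂ hf.integrable
    _ ≤ _ := sum_mul_enorm_integral_der_le_coeffNorm_mul_sobNorm (fun i => by positivity)
        (by positivity) hpq measurable

end Assembly

end WalshSobolev

theorem mainTheorem6_general (b : ℕ) [NeZero b] (hb : 2 ≤ b) (α k : ℕ) (hα : 0 < α) (hk : 0 < k)
    (p q : ENNReal) (hpq : p.HolderConjugate q) (f : ℝ → ℝ)
    (hf : ∀ i < α, AbsolutelyContinuousOnInterval (WalshSobolev.der i f) 0 1) :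
    ‖WalshSobolev.walshCoeff b f k‖ₑ ≤
      ENNReal.ofReal
          ((b : ℝ) ^ (-(WalshSobolev.mu b α k : ℤ)) * WalshSobolev.boundConst b α q) *
        WalshSobolev.sobNorm p α f := by
  obtain ⟨β, rfl⟩ := Nat.exists_eq_add_of_le' hα
  exact WalshSobolev.enorm_walshCoeff_le hb hk
    (WalshSobolev.IsSobolevOne.of_absolutelyContinuous hα hf) hpq

theorem mainTheorem6 (b : ℕ) [NeZero b] (hb : 2 ≤ b) (α k : ℕ) (hα : 0 < α) (hk : 0 < k)
    (p q : ENNReal) (hpq : p.HolderConjugate q) (f : ℝ → ℝ) (hf : f ∈ WalshSobolev.Sob α) :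
    ‖WalshSobolev.walshCoeff b f k‖ₑ ≤
      ENNReal.ofReal
          ((b : ℝ) ^ (-(WalshSobolev.mu b α k : ℤ)) * WalshSobolev.boundConst b α q) *
        WalshSobolev.sobNorm p α f :=
  mainTheorem6_general b hb α k hα hk p q hpq f hf.2.1
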